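/- Manifolds and Lie groups are Hausdorff, smooth (in the sense of Michal--Bastiani) and modelled on arbitrary real Hausdorff locally convex spaces; the model space may vary from chart to chart. A subset $N \subseteq M$ is a submanifold if around each of its points there is a chart $\varphi : U \to \varphi(U) \subseteq E$ of $M$ with $\varphi(U \cap N) = \varphi(U) \cap F$ for a closed linear subspace $F$ of $E$. A submersion is a smooth map that, in suitable charts around every point, is a continuous linear map with a continuous linear right inverse. Let $G$ be a Lie group acting smoothly on a manifold $M$. For $m \in M$ let $G_m$ be its stabilizer, and for a subgroup $H \subseteq G$ let $M_{(H)} = \{ m \in M : G_m \text{ is conjugate to } H \}$. The action is proper if preimages of compact sets under $G \times M \to M \times M$, $(g, m) \mapsto (g \cdot m, m)$, are compact. A slice at $m \in M$ is a submanifold $S \subseteq M$ containing $m$ such that 1. $G_m \cdot S \subseteq S$; 2. every $g \in G$ with $(g \cdot S) \cap S \neq \emptyset$ lies in $G_m$; 3. $G_m$ is a Lie subgroup (a subgroup that is a submanifold) of $G$, the projection $G \to G/G_m$ is a smooth principal $G_m$-bundle (for some smooth structure on $G/G_m$ with the quotient topology), and it has a smooth local section $\chi : U \to G$ on an open neighborhood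 $U$ of the identity coset such that $U \times S \to M$, $([g], s) \mapsto \chi([g]) \cdot s$, is a diffeomorphism onto an open neighborhood of $m$; 4. $S \cap M_{(G_m)}$ is a closed subset and a submanifold of $S$. **Proposition.** Assume that the action of $G$ on $M$ is proper and admits a slice at every point of $M$, and let $H \subseteq G$ be a stabilizer subgroup, that is, $H = G_m$ for some $m \in M$. Then $M_{(H)}$ is a submanifold of $M$, and the quotient $M_{(H)}/G$ carries a unique smooth structure (a topology together with a maximal smooth atlas) such that the canonical projection $M_{(H)} \to M_{(H)}/G$ is a smooth submersion. If $M \times M$ is compactly generated (its topology is determined by its compact subsets), then this topology on $M_{(H)}/G$ is Hausdorff, so that $M_{(H)}/G$ is a manifold. -/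

import Mathlib

open Set Filter Topology

universe u v

/-- `w` is the derivative of `f` at `x` in the direction `h`:
`w = lim_{t → 0} (f (x + t h) - f x) / t`. -/
def HasDirDeriv {E : Type u} {F : Type v}
    [AddCommGroup E] [Module ℝ E]
    [AddCommGroup F] [Module ℝ F] [TopologicalSpace F]
    (f : E → F) (x h : E) (w : F) : Prop :=
  Tendsto (fun t : ℝ => t⁻¹ • (f (x + t • h) - f x)) (𝓝[≠] 0) (𝓝 w)

/-- Maps of class `C^n` in the sense of Michal and Bastiani on an open subset `s` of a locally
convex space: `f` is `C^0` if it is continuous, and it is `C^(n+1)` if all directional derivatives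
exist at the points of `s` and `df : s × E → F` is of class `C^n`. -/
def BastianiCOn : ∀ (_n : ℕ) {E : Type u} {F : Type v}
    [AddCommGroup E] [Module ℝ E] [TopologicalSpace E]
    [AddCommGroup F] [Module ℝ F] [TopologicalSpace F]
    (_f : E → F) (_s : Set E), Prop
  | 0, _, _, _, _, _, _, _, _, f, s => ContinuousOn f s
  | n + 1, E, F, _, _, _, _, _, _, f, s =>
      ContinuousOn f s ∧ ∃ df : E × E → F,
        (∀ x ∈ s, ∀ h : E, HasDirDeriv f x h (df (x, h))) ∧
          BastianiCOn n df (s ×ˢ (univ : Set E))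

/-- Smooth maps on an open subset of a locally convex space. -/
def BastianiSmoothOn {E : Type u} {F : Type v}
    [AddCommGroup E] [Module ℝ E] [TopologicalSpace E]
    [AddCommGroup F] [Module ℝ F] [TopologicalSpace F]
    (f : E → F) (s : Set E) : Prop :=
  ∀ n : ℕ, BastianiCOn n f s

/-- A chart of a topological space `X`: a homeomorphism from an open subset of `X` onto an open
subset of a real Hausdorff locally convex space. The model space is part of the chart, so it may
vary from chart to chart. -/
structure LCChart (X : Type u) [TopologicalSpace X] where
  E : Type u
  [addCommGroup : AddCommGroup E]
  [module : Module ℝ E]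
  [topology : TopologicalSpace E]
  [isTopologicalAddGroup : IsTopologicalAddGroup E]
  [continuousSMul : ContinuousSMul ℝ E]
  [locallyConvexSpace : LocallyConvexSpace ℝ E]
  [t2Space : T2Space E]
  toHomeo : OpenPartialHomeomorph X E

attribute [instance] LCChart.addCommGroup LCChart.module LCChart.topology
  LCChart.isTopologicalAddGroup LCChart.continuousSMul LCChart.locallyConvexSpace LCChart.t2Space

/-- The product of two charts. -/
def LCChart.prod {X : Type u} {Y : Type v} [TopologicalSpace X] [TopologicalSpace Y]
    (c : LCChart X) (d : LCChart Y) : LCChart (X × Y) where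
  E := c.E × d.E
  toHomeo := c.toHomeo.prod d.toHomeo

/-- Two charts are compatible if both changes of coordinates are smooth. -/
def LCChart.Compatible {X : Type u} [TopologicalSpace X] (c d : LCChart X) : Prop :=
  BastianiSmoothOn (d.toHomeo ∘ c.toHomeo.symm)
      (c.toHomeo.target ∩ c.toHomeo.symm ⁻¹' d.toHomeo.source) ∧
    BastianiSmoothOn (c.toHomeo ∘ d.toHomeo.symm)
      (d.toHomeo.target ∩ d.toHomeo.symm ⁻¹' c.toHomeo.source)

/-- The charts that are compatible with all charts of `A`. If `A` is a smooth atlas, this is the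
maximal smooth atlas that contains `A`. -/
def maximalAtlas {X : Type u} [TopologicalSpace X] (A : Set (LCChart X)) : Set (LCChart X) :=
  {c | ∀ d ∈ A, c.Compatible d}

/-- The charts of a product of manifolds given by the products of charts of the factors. -/
def prodAtlas {X : Type u} {Y : Type v} [TopologicalSpace X] [TopologicalSpace Y]
    (A : Set (LCChart X)) (B : Set (LCChart Y)) : Set (LCChart (X × Y)) :=
  {e | ∃ c ∈ A, ∃ d ∈ B, e = c.prod d}

/-- A smooth structure on a topological space `X`, given by a maximal atlas of pairwise smoothly
compatible charts. A manifold is a Hausdorff space with a smooth structure. -/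
structure SmoothStructure (X : Type u) [TopologicalSpace X] where
  atlas : Set (LCChart X)
  cover : ∀ x : X, ∃ c ∈ atlas, x ∈ c.toHomeo.source
  compatible : ∀ c ∈ atlas, ∀ d ∈ atlas, c.Compatible d
  maximal : ∀ c : LCChart X, (∀ d ∈ atlas, c.Compatible d) → c ∈ atlas

/-- A topology on the set `X` together with a smooth structure for this topology. -/
structure TopSmoothStructure (X : Type u) where
  top : TopologicalSpace X
  smooth : @SmoothStructure X top

/-- Smoothness, with respect to the atlases `A` and `B`, of the map `f` on the open set `s`. -/
def SmoothMapOn {X : Type u} {Y : Type v} [TopologicalSpace X] [TopologicalSpace Y]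
    (A : Set (LCChart X)) (B : Set (LCChart Y)) (f : X → Y) (s : Set X) : Prop :=
  ContinuousOn f s ∧ ∀ c ∈ A, ∀ d ∈ B,
    BastianiSmoothOn (d.toHomeo ∘ f ∘ c.toHomeo.symm)
      (c.toHomeo.target ∩ c.toHomeo.symm ⁻¹' (s ∩ f ⁻¹' d.toHomeo.source))

/-- A homeomorphism from an open subset of `X` onto an open subset of `Y` is a diffeomorphism. -/
def IsDiffeo {X : Type u} {Y : Type v} [TopologicalSpace X] [TopologicalSpace Y]
    (A : Set (LCChart X)) (B : Set (LCChart Y)) (e : OpenPartialHomeomorph X Y) : Prop :=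
  SmoothMapOn A B e e.source ∧ SmoothMapOn B A e.symm e.target

/-- Submersions: smooth maps that are given, in suitable charts around every point of the domain,
by a continuous linear map with a continuous linear right inverse, that is, by the projection of a
topological direct sum onto one summand. -/
def IsSubmersion {X : Type u} {Y : Type v} [TopologicalSpace X] [TopologicalSpace Y]
    (A : Set (LCChart X)) (B : Set (LCChart Y)) (f : X → Y) : Prop :=
  SmoothMapOn A B f univ ∧ ∀ x : X, ∃ c ∈ maximalAtlas A, ∃ d ∈ maximalAtlas B,
    x ∈ c.toHomeo.source ∧ MapsTo f c.toHomeo.source d.toHomeo.source ∧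
      ∃ (p : c.E →L[ℝ] d.E) (σ : d.E →L[ℝ] c.E), (∀ z : d.E, p (σ z) = z) ∧
        ∀ y ∈ c.toHomeo.source, d.toHomeo (f y) = p (c.toHomeo y)

/-- The charts induced on a subset `N` of a manifold with atlas `A`: if a chart `φ : U → φ(U) ⊆ E`
in `A` satisfies `φ(U ∩ N) = φ(U) ∩ F` for a closed linear subspace `F` of `E`, then `φ` restricts
to a chart of `N` with domain `U ∩ N` and model space `F`. The space `F` is given here as the range
of a linear closed embedding `ι`. -/
def subAtlas {X : Type u} [TopologicalSpace X] (A : Set (LCChart X)) (N : Set X) :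
    Set (LCChart N) :=
  {c | ∃ φ ∈ A, ∃ ι : c.E →L[ℝ] φ.E, IsClosedEmbedding ι ∧
    φ.toHomeo '' (φ.toHomeo.source ∩ N) = φ.toHomeo.target ∩ range ι ∧
    c.toHomeo.source = Subtype.val ⁻¹' φ.toHomeo.source ∧
    ∀ x ∈ c.toHomeo.source, ι (c.toHomeo x) = φ.toHomeo x}

/-- `N` is a submanifold of the manifold with the maximal atlas `A`: around each of its points
there is a chart in which `N` is a closed linear subspace. -/
def IsSubmanifold {X : Type u} [TopologicalSpace X] (A : Set (LCChart X)) (N : Set X) : Prop :=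
  ∀ x : N, ∃ c ∈ subAtlas A N, x ∈ c.toHomeo.source

/-- The smooth structure makes the group `G` a Lie group. -/
def IsLieGroupStructure {G : Type v} [Group G] [TopologicalSpace G]
    (𝒢 : SmoothStructure G) : Prop :=
  SmoothMapOn (prodAtlas 𝒢.atlas 𝒢.atlas) 𝒢.atlas (fun p : G × G => p.1 * p.2) univ ∧
    SmoothMapOn 𝒢.atlas 𝒢.atlas (fun g : G => g⁻¹) univ

/-- The action of the Lie group `G` on the manifold `M` is smooth. -/
def IsSmoothAction {G : Type v} {M : Type u} [Group G] [TopologicalSpace G] [TopologicalSpace M]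
    [MulAction G M] (𝒢 : SmoothStructure G) (ℳ : SmoothStructure M) : Prop :=
  SmoothMapOn (prodAtlas 𝒢.atlas ℳ.atlas) ℳ.atlas (fun p : G × M => p.1 • p.2) univ

/-- The action is proper: the map `(g, m) ↦ (g • m, m)` has compact preimages of compact sets. -/
def IsProperAction (G : Type v) (M : Type u) [Group G] [TopologicalSpace G] [TopologicalSpace M]
    [MulAction G M] : Prop :=
  ∀ K : Set (M × M), IsCompact K → IsCompact ((fun p : G × M => (p.1 • p.2, p.2)) ⁻¹' K)

/-- For the smooth structure `𝒬` on `G ⧸ H` (with the quotient topology), the projection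
`G → G ⧸ H` is a smooth principal `H`-bundle: it is smooth and has `H`-equivariant smooth local
trivializations `U × H → π⁻¹(U)`. -/
def IsPrincipalBundle {G : Type v} [Group G] [TopologicalSpace G]
    (𝒢 : SmoothStructure G) (H : Subgroup G) (𝒬 : SmoothStructure (G ⧸ H)) : Prop :=
  SmoothMapOn 𝒢.atlas 𝒬.atlas (fun g : G => (g : G ⧸ H)) univ ∧
  ∀ q : G ⧸ H, ∃ U : Set (G ⧸ H), IsOpen U ∧ q ∈ U ∧
    ∃ e : OpenPartialHomeomorph ((G ⧸ H) × (H : Set G)) G,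
      e.source = U ×ˢ univ ∧ e.target = (fun g : G => (g : G ⧸ H)) ⁻¹' U ∧
      (∀ y ∈ U, ∀ h : H, ((e (y, h) : G) : G ⧸ H) = y) ∧
      (∀ y ∈ U, ∀ h k : H, e (y, h * k) = e (y, h) * (k : G)) ∧
      IsDiffeo (prodAtlas 𝒬.atlas (subAtlas 𝒢.atlas (H : Set G))) 𝒢.atlas e

/-- The set `M_(H)` of the points whose stabilizer is conjugate to `H`. -/
def orbitTypeSet {G : Type v} (M : Type u) [Group G] [MulAction G M] (H : Subgroup G) : Set M :=
  {m | ∃ a : G, MulAction.stabilizer G m = H.map (MulAut.conj a).toMonoidHom}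

/-- `S` is a slice at `m` for the action of the Lie group `G` on the manifold `M`. -/
structure IsSlice {G : Type v} {M : Type u} [Group G] [TopologicalSpace G] [TopologicalSpace M]
    [MulAction G M] (𝒢 : SmoothStructure G) (ℳ : SmoothStructure M) (m : M) (S : Set M) :
    Prop where
  mem : m ∈ S
  submanifold : IsSubmanifold ℳ.atlas S
  stabilizer_smul_mem : ∀ g ∈ MulAction.stabilizer G m, ∀ s ∈ S, g • s ∈ S
  mem_stabilizer : ∀ g : G, ∀ s ∈ S, g • s ∈ S → g ∈ MulAction.stabilizer G m
  /-- The stabilizer `G_m` is a Lie subgroup. -/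
  lieSubgroup : IsSubmanifold 𝒢.atlas (MulAction.stabilizer G m : Set G)
  /-- The Lie subgroup `G_m` is principal, and there is a smooth local section `χ` of
  `G → G ⧸ G_m`, defined on an open neighborhood `U` of the identity coset, such that
  `U × S → M`, `(q, s) ↦ χ(q) • s`, is a diffeomorphism onto an open neighborhood of `m`. -/
  principal : ∃ 𝒬 : SmoothStructure (G ⧸ MulAction.stabilizer G m),
    IsPrincipalBundle 𝒢 (MulAction.stabilizer G m) 𝒬 ∧
    ∃ (U : Set (G ⧸ MulAction.stabilizer G m)) (χ : G ⧸ MulAction.stabilizer G m → G),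
      IsOpen U ∧ ((1 : G) : G ⧸ MulAction.stabilizer G m) ∈ U ∧
      SmoothMapOn 𝒬.atlas 𝒢.atlas χ U ∧
      (∀ q ∈ U, (χ q : G ⧸ MulAction.stabilizer G m) = q) ∧
      ∃ e : OpenPartialHomeomorph ((G ⧸ MulAction.stabilizer G m) × S) M,
        e.source = U ×ˢ univ ∧ (∀ q ∈ U, ∀ s : S, e (q, s) = χ q • (s : M)) ∧
        m ∈ e.target ∧ IsDiffeo (prodAtlas 𝒬.atlas (subAtlas ℳ.atlas S)) ℳ.atlas e
  /-- The partial slice `S_(G_m)` is a closed subset of `S` and a submanifold of `S`. -/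
  partialSlice_closed :
    IsClosed ((Subtype.val : S → M) ⁻¹' orbitTypeSet M (MulAction.stabilizer G m))
  partialSlice_submanifold : IsSubmanifold (maximalAtlas (subAtlas ℳ.atlas S))
    ((Subtype.val : S → M) ⁻¹' orbitTypeSet M (MulAction.stabilizer G m))

/-- Two points of `M_(H)` are equivalent if they lie on the same `G`-orbit. -/
def orbitTypeSetoid {G : Type v} (M : Type u) [Group G] [MulAction G M] (H : Subgroup G) :
    Setoid (orbitTypeSet M H) :=
  (MulAction.orbitRel G M).comap Subtype.val

/-- The quotient `M_(H) / G`. -/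
def OrbitTypeQuotient {G : Type v} (M : Type u) [Group G] [MulAction G M] (H : Subgroup G) :
    Type u :=
  Quotient (orbitTypeSetoid M H)

/-- The canonical projection `M_(H) → M_(H) / G`. -/
def orbitTypeProj {G : Type v} (M : Type u) [Group G] [MulAction G M] (H : Subgroup G) :
    orbitTypeSet M H → OrbitTypeQuotient M H :=
  Quotient.mk (orbitTypeSetoid M H)

/-- For the topology and the smooth structure `𝒮` on `M_(H) / G`, the canonical projection
`M_(H) → M_(H) / G` is a smooth submersion; here `M_(H)` carries the smooth structure induced
from `M`. -/
def IsSubmersiveQuotientStructure {G : Type v} {M : Type u} [Group G] [TopologicalSpace M]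
    [MulAction G M] (ℳ : SmoothStructure M) (H : Subgroup G)
    (𝒮 : TopSmoothStructure (OrbitTypeQuotient M H)) : Prop :=
  @IsSubmersion _ _ _ 𝒮.top (subAtlas ℳ.atlas (orbitTypeSet M H))
    (@SmoothStructure.atlas _ 𝒮.top 𝒮.smooth)
    (orbitTypeProj M H)

section Calculus

variable {E F K : Type*}
  [AddCommGroup E] [Module ℝ E]
  [AddCommGroup F] [Module ℝ F] [TopologicalSpace F]
  [AddCommGroup K] [Module ℝ K] [TopologicalSpace K]

theorem HasDirDeriv.unique [T2Space F] {f : E → F} {x h : E} {w w' : F}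
    (hw : HasDirDeriv f x h w) (hw' : HasDirDeriv f x h w') : w = w' :=
  tendsto_nhds_unique hw hw'

theorem tendsto_add_smul [TopologicalSpace E] [ContinuousAdd E] [ContinuousSMul ℝ E] (x h : E) :
    Tendsto (fun t : ℝ => x + t • h) (𝓝[≠] 0) (𝓝 x) := by
  have : Continuous fun t : ℝ => x + t • h := by fun_prop
  have h0 := this.tendsto 0
  simp only [zero_smul, add_zero] at h0
  exact h0.mono_left nhdsWithin_le_nhds

theorem HasDirDeriv.congr [TopologicalSpace E] [ContinuousAdd E] [ContinuousSMul ℝ E] {f g : E → F} {x h : E} {w : F}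
    (hw : HasDirDeriv f x h w) (hfg : f =ᶠ[𝓝 x] g) : HasDirDeriv g x h w := by
  refine Tendsto.congr' ?_ hw
  filter_upwards [(tendsto_add_smul x h).eventually hfg] with t ht
  rw [ht, hfg.self_of_nhds]

theorem HasDirDeriv.rescale [ContinuousConstSMul ℝ F] {f : E → F} {x h : E} {w : F}
    (hw : HasDirDeriv f x h w) {r : ℝ} (hr : r ≠ 0) : HasDirDeriv f x (r • h) (r • w) := by
  have h1 : Tendsto (fun t : ℝ => t * r) (𝓝[≠] 0) (𝓝[≠] 0) := by
    refine tendsto_nhdsWithin_of_tendsto_nhds_of_eventually_within _ ?_ ?_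
    · have : Continuous fun t : ℝ => t * r := by fun_prop
      have h0 := this.tendsto 0
      simp only [zero_mul] at h0
      exact h0.mono_left nhdsWithin_le_nhds
    · filter_upwards [self_mem_nhdsWithin] with t ht
      exact mul_ne_zero ht hr
  refine Tendsto.congr' ?_ ((hw.comp h1).const_smul r)
  filter_upwards [self_mem_nhdsWithin] with t ht
  simp only [Function.comp_apply, smul_smul, mul_inv]
  congr 1
  field_simp

theorem HasDirDeriv.clm_comp {f : E → F} {x h : E} {w : F} (hw : HasDirDeriv f x h w)
    (L : F →L[ℝ] K) : HasDirDeriv (fun y => L (f y)) x h (L w) := by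
  have := (L.continuous.tendsto w).comp hw
  refine this.congr fun t => ?_
  simp

theorem hasDirDeriv_clm [TopologicalSpace E] (L : E →L[ℝ] F) (x h : E) : HasDirDeriv L x h (L h) := by
  refine tendsto_const_nhds.congr' ?_
  filter_upwards [self_mem_nhdsWithin] with t ht
  have ht : t ≠ 0 := ht
  simp [smul_smul, ht]

/-- The mean value theorem for a line segment, for functions with values in a locally convex
space. -/
theorem sub_mem_of_hasDirDeriv [IsTopologicalAddGroup F] [ContinuousSMul ℝ F]
    [LocallyConvexSpace ℝ F] {f : E → F} {x h : E} {w : ℝ → F} {C : Set F}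
    (hC : Convex ℝ C) (hC' : IsClosed C)
    (hd : ∀ s ∈ Icc (0 : ℝ) 1, HasDirDeriv f (x + s • h) h (w s))
    (hw : ∀ s ∈ Icc (0 : ℝ) 1, w s ∈ C) : f (x + h) - f x ∈ C := by
  by_contra hn
  obtain ⟨l, r, hl, hr⟩ := geometric_hahn_banach_point_closed hC hC' hn
  set g : ℝ → ℝ := fun s => l (f (x + s • h)) with hg
  have hder : ∀ s ∈ Icc (0 : ℝ) 1, HasDerivAt g (l (w s)) s := by
    intro s hs
    rw [hasDerivAt_iff_tendsto_slope_zero]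
    refine (((l.continuous.tendsto _).comp (hd s hs))).congr fun t => ?_
    simp [hg, add_smul, add_assoc]
  obtain ⟨c, hc, hc'⟩ := exists_hasDerivAt_eq_slope g (fun s => l (w s)) zero_lt_one
    (fun s hs => (hder s hs).continuousAt.continuousWithinAt)
    (fun s hs => hder s (Ioo_subset_Icc_self hs))
  have h1 := hr _ (hw c (Ioo_subset_Icc_self hc))
  simp only [hg, one_smul, zero_smul, add_zero, sub_zero, div_one] at hc'
  rw [map_sub] at hl
  linarith

theorem exists_closed_convex_nhds [IsTopologicalAddGroup F] [ContinuousSMul ℝ F]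
    [LocallyConvexSpace ℝ F] {y : F} {V : Set F} (hV : V ∈ 𝓝 y) :
    ∃ C ∈ 𝓝 y, Convex ℝ C ∧ IsClosed C ∧ C ⊆ V := by
  obtain ⟨V', hV', hc, hs⟩ := exists_mem_nhds_isClosed_subset hV
  obtain ⟨C, ⟨hC1, hC2⟩, hC3⟩ :=
    (LocallyConvexSpace.convex_basis (𝕜 := ℝ) y).mem_iff.1 hV'
  exact ⟨closure C, mem_of_superset hC1 subset_closure, hC2.closure, isClosed_closure,
    (closure_minimal hC3 hc).trans hs⟩

/-- The difference quotients of a map of class `C^1` converge locally uniformly. -/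
theorem tendsto_diffQuot [TopologicalSpace E] [IsTopologicalAddGroup E] [ContinuousSMul ℝ E]
    [IsTopologicalAddGroup F] [ContinuousSMul ℝ F] [LocallyConvexSpace ℝ F]
    {f : E → F} {df : E × E → F} {s : Set E} (hs : IsOpen s)
    (hd : ∀ x ∈ s, ∀ h : E, HasDirDeriv f x h (df (x, h)))
    (hc : ContinuousOn df (s ×ˢ univ)) {x : E} (hx : x ∈ s) (h : E) :
    Tendsto (fun q : (E × E) × ℝ => q.2⁻¹ • (f (q.1.1 + q.2 • q.1.2) - f q.1.1))
      ((𝓝 (x, h)) ×ˢ 𝓝[≠] 0) (𝓝 (df (x, h))) := by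
  intro V hV
  obtain ⟨C, hC, hCc, hCcl, hCV⟩ := exists_closed_convex_nhds hV
  have hsx : s ×ˢ (univ : Set E) ∈ 𝓝 (x, h) := prod_mem_nhds (hs.mem_nhds hx) univ_mem
  have hA : ∀ᶠ p in 𝓝 (x, h), p.1 ∈ s ∧ df p ∈ C := by
    filter_upwards [hsx, (hc.continuousAt hsx).preimage_mem_nhds hC] with p hp hp'
    exact ⟨hp.1, hp'⟩
  have hev : ∀ᶠ q : (E × E) × ℝ in 𝓝 (x, h) ×ˢ 𝓝 0, ∀ τ ∈ Icc (0 : ℝ) 1,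
      (q.1.1 + (τ * q.2) • q.1.2) ∈ s ∧ df (q.1.1 + (τ * q.2) • q.1.2, q.1.2) ∈ C := by
    rw [← nhds_prod_eq]
    refine isCompact_Icc.eventually_forall_of_forall_eventually fun τ _ => ?_
    have hcont : Continuous fun z : ((E × E) × ℝ) × ℝ =>
        (z.1.1.1 + (z.2 * z.1.2) • z.1.1.2, z.1.1.2) := by fun_prop
    have h0 := hcont.tendsto (((x, h), 0), τ)
    simp only [mul_zero, zero_smul, add_zero] at h0
    exact h0.eventually hA
  have hle : (𝓝 (x, h)) ×ˢ 𝓝[≠] (0 : ℝ) ≤ 𝓝 (x, h) ×ˢ 𝓝 0 :=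
    Filter.prod_mono le_rfl nhdsWithin_le_nhds
  have hne : ∀ᶠ q : (E × E) × ℝ in (𝓝 (x, h)) ×ˢ 𝓝[≠] (0 : ℝ), q.2 ≠ 0 :=
    tendsto_snd.eventually self_mem_nhdsWithin
  rw [mem_map]
  filter_upwards [hle hev, hne] with q hq hq0
  refine hCV ?_
  have key := sub_mem_of_hasDirDeriv (f := fun y => q.2⁻¹ • f y) (x := q.1.1) (h := q.2 • q.1.2)
    (w := fun τ => df (q.1.1 + (τ * q.2) • q.1.2, q.1.2)) hCc hCcl ?_ (fun τ hτ => (hq τ hτ).2)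
  · rwa [← smul_sub] at key
  · intro τ hτ
    have h1 := ((hd _ (hq τ hτ).1 q.1.2).rescale hq0).clm_comp
      (q.2⁻¹ • ContinuousLinearMap.id ℝ F)
    simpa [smul_smul, hq0] using h1

theorem HasDirDeriv.comp [TopologicalSpace E] [IsTopologicalAddGroup E] [ContinuousSMul ℝ E]
    [IsTopologicalAddGroup F] [ContinuousSMul ℝ F]
    [IsTopologicalAddGroup K] [ContinuousSMul ℝ K] [LocallyConvexSpace ℝ K]
    {g : F → K} {dg : F × F → K} {t : Set F} (ht : IsOpen t)
    (hd : ∀ y ∈ t, ∀ h : F, HasDirDeriv g y h (dg (y, h)))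
    (hc : ContinuousOn dg (t ×ˢ univ)) {f : E → F} {x h : E} {w : F} (hx : f x ∈ t)
    (hf : HasDirDeriv f x h w) : HasDirDeriv (g ∘ f) x h (dg (f x, w)) := by
  have h1 := tendsto_diffQuot ht hd hc hx w
  have h2 : Tendsto (fun τ : ℝ => ((f x, τ⁻¹ • (f (x + τ • h) - f x)), τ)) (𝓝[≠] 0)
      ((𝓝 (f x, w)) ×ˢ 𝓝[≠] 0) := by
    refine Tendsto.prodMk ?_ tendsto_id
    rw [nhds_prod_eq]
    exact tendsto_const_nhds.prodMk hf
  refine (h1.comp h2).congr' ?_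
  filter_upwards [self_mem_nhdsWithin] with τ hτ
  have hτ : τ ≠ 0 := hτ
  simp [smul_smul, hτ]

theorem HasDirDeriv.additive [TopologicalSpace E] [IsTopologicalAddGroup E] [ContinuousSMul ℝ E]
    [IsTopologicalAddGroup F] [ContinuousSMul ℝ F] [LocallyConvexSpace ℝ F] [T2Space F]
    {f : E → F} {df : E × E → F} {s : Set E} (hs : IsOpen s)
    (hd : ∀ x ∈ s, ∀ h : E, HasDirDeriv f x h (df (x, h)))
    (hc : ContinuousOn df (s ×ˢ univ)) {x : E} (hx : x ∈ s) (h k : E) :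
    df (x, h + k) = df (x, h) + df (x, k) := by
  have h1 := tendsto_diffQuot hs hd hc hx k
  have h2 : Tendsto (fun τ : ℝ => ((x + τ • h, k), τ)) (𝓝[≠] 0) ((𝓝 (x, k)) ×ˢ 𝓝[≠] 0) := by
    refine Tendsto.prodMk ?_ tendsto_id
    rw [nhds_prod_eq]
    exact (tendsto_add_smul x h).prodMk tendsto_const_nhds
  have h3 := Tendsto.add (hd x hx h) (h1.comp h2)
  refine HasDirDeriv.unique (hd x hx (h + k)) (h3.congr fun τ => ?_)
  simp only [Function.comp_apply, ← smul_add, add_assoc]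
  congr 1
  abel

theorem hasDirDeriv_zero {f : E → F} (x : E) : HasDirDeriv f x 0 0 := by
  refine tendsto_const_nhds.congr fun t => ?_
  simp

theorem HasDirDeriv.smul [TopologicalSpace E] [IsTopologicalAddGroup E] [ContinuousSMul ℝ E]
    [ContinuousSMul ℝ F] [T2Space F] {f : E → F} {x h : E} {w w' : F} {r : ℝ}
    (hw : HasDirDeriv f x h w) (hw' : HasDirDeriv f x (r • h) w') : w' = r • w := by
  by_cases hr : r = 0
  · subst hr
    rw [zero_smul] at hw' ⊢
    exact hw'.unique (hasDirDeriv_zero x)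
  · exact hw'.unique (hw.rescale hr)

end Calculus

section Smooth

theorem BastianiCOn.continuousOn {n : ℕ} {E F : Type*}
    [AddCommGroup E] [Module ℝ E] [TopologicalSpace E]
    [AddCommGroup F] [Module ℝ F] [TopologicalSpace F] {f : E → F} {s : Set E}
    (hf : BastianiCOn n f s) : ContinuousOn f s := by
  cases n with
  | zero => exact hf
  | succ n => exact hf.1

theorem BastianiCOn.mono {n : ℕ} {E F : Type*}
    [AddCommGroup E] [Module ℝ E] [TopologicalSpace E]
    [AddCommGroup F] [Module ℝ F] [TopologicalSpace F] {f : E → F} {s t : Set E}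
    (hf : BastianiCOn n f s) (h : t ⊆ s) : BastianiCOn n f t := by
  induction n generalizing E F with
  | zero => exact ContinuousOn.mono hf h
  | succ n ih =>
    obtain ⟨h0, df, h1, h2⟩ := hf
    exact ⟨h0.mono h, df, fun x hx => h1 x (h hx), ih h2 (prod_mono h Subset.rfl)⟩

theorem BastianiCOn.of_succ {n : ℕ} {E F : Type*}
    [AddCommGroup E] [Module ℝ E] [TopologicalSpace E]
    [AddCommGroup F] [Module ℝ F] [TopologicalSpace F] {f : E → F} {s : Set E}
    (hf : BastianiCOn (n + 1) f s) : BastianiCOn n f s := by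
  induction n generalizing E F with
  | zero => exact hf.1
  | succ n ih =>
    obtain ⟨h0, df, h1, h2⟩ := hf
    exact ⟨h0, df, h1, ih h2⟩

theorem BastianiCOn.congr {n : ℕ} {E F : Type*}
    [AddCommGroup E] [Module ℝ E] [TopologicalSpace E] [ContinuousAdd E] [ContinuousSMul ℝ E]
    [AddCommGroup F] [Module ℝ F] [TopologicalSpace F] {f g : E → F} {s : Set E}
    (hf : BastianiCOn n f s) (hs : IsOpen s) (h : EqOn f g s) : BastianiCOn n g s := by
  cases n with
  | zero => exact ContinuousOn.congr hf h.symm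
  | succ n =>
    obtain ⟨h0, df, h1, h2⟩ := hf
    exact ⟨h0.congr h.symm, df,
      fun x hx v => (h1 x hx v).congr (h.eventuallyEq_of_mem (hs.mem_nhds hx)), h2⟩

theorem ContinuousLinearMap.bastianiCOn (n : ℕ) {E F : Type*}
    [AddCommGroup E] [Module ℝ E] [TopologicalSpace E]
    [AddCommGroup F] [Module ℝ F] [TopologicalSpace F] (L : E →L[ℝ] F) (s : Set E) :
    BastianiCOn n L s := by
  induction n generalizing E F with
  | zero => exact L.continuous.continuousOn
  | succ n ih =>
    exact ⟨L.continuous.continuousOn, L.comp (ContinuousLinearMap.snd ℝ E E),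
      fun x _ h => hasDirDeriv_clm L x h, ih _ _⟩

theorem bastianiCOn_const (n : ℕ) {E F : Type*}
    [AddCommGroup E] [Module ℝ E] [TopologicalSpace E]
    [AddCommGroup F] [Module ℝ F] [TopologicalSpace F] (a : F) (s : Set E) :
    BastianiCOn n (fun _ : E => a) s := by
  induction n generalizing E a with
  | zero => exact continuousOn_const
  | succ n ih =>
    refine ⟨continuousOn_const, fun _ => 0, fun x _ h => ?_, ih _ _⟩
    exact tendsto_const_nhds.congr fun t => by simp

theorem BastianiCOn.prodMk {n : ℕ} {E F K : Type*}
    [AddCommGroup E] [Module ℝ E] [TopologicalSpace E]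
    [AddCommGroup F] [Module ℝ F] [TopologicalSpace F]
    [AddCommGroup K] [Module ℝ K] [TopologicalSpace K]
    {f : E → F} {g : E → K} {s : Set E}
    (hf : BastianiCOn n f s) (hg : BastianiCOn n g s) :
    BastianiCOn n (fun x => (f x, g x)) s := by
  induction n generalizing E F K with
  | zero => exact ContinuousOn.prodMk hf hg
  | succ n ih =>
    obtain ⟨h0, df, h1, h2⟩ := hf
    obtain ⟨k0, dg, k1, k2⟩ := hg
    refine ⟨h0.prodMk k0, fun p => (df p, dg p), fun x hx v => ?_, ih h2 k2⟩
    have := Tendsto.prodMk_nhds (h1 x hx v) (k1 x hx v)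
    exact this

theorem BastianiCOn.comp_clm {n : ℕ} {E F K : Type*}
    [AddCommGroup E] [Module ℝ E] [TopologicalSpace E]
    [AddCommGroup F] [Module ℝ F] [TopologicalSpace F]
    [AddCommGroup K] [Module ℝ K] [TopologicalSpace K]
    {f : F → K} {t : Set F} (hf : BastianiCOn n f t) (L : E →L[ℝ] F) :
    BastianiCOn n (f ∘ L) (L ⁻¹' t) := by
  induction n generalizing E F with
  | zero => exact ContinuousOn.comp hf L.continuous.continuousOn (mapsTo_preimage _ _)
  | succ n ih =>
    obtain ⟨h0, df, h1, h2⟩ := hf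
    refine ⟨h0.comp L.continuous.continuousOn (mapsTo_preimage _ _), df ∘ (L.prodMap L),
      fun x hx h => ?_, ?_⟩
    · refine Tendsto.congr (fun t => ?_) (h1 (L x) hx (L h))
      simp only [Function.comp_apply, map_add, map_smul]
    · exact (ih h2 (L.prodMap L)).mono fun p hp => ⟨hp.1, mem_univ _⟩

theorem BastianiCOn.comp {n : ℕ} {E F K : Type*}
    [AddCommGroup E] [Module ℝ E] [TopologicalSpace E] [IsTopologicalAddGroup E]
    [ContinuousSMul ℝ E]
    [AddCommGroup F] [Module ℝ F] [TopologicalSpace F] [IsTopologicalAddGroup F]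
    [ContinuousSMul ℝ F]
    [AddCommGroup K] [Module ℝ K] [TopologicalSpace K] [IsTopologicalAddGroup K]
    [ContinuousSMul ℝ K] [LocallyConvexSpace ℝ K]
    {g : F → K} {f : E → F} {t : Set F} {s : Set E}
    (hg : BastianiCOn n g t) (hf : BastianiCOn n f s) (ht : IsOpen t) (hst : MapsTo f s t) :
    BastianiCOn n (g ∘ f) s := by
  induction n generalizing E F K with
  | zero => exact ContinuousOn.comp hg hf hst
  | succ n ih =>
    have hf' := hf.of_succ
    obtain ⟨h0, df, h1, h2⟩ := hf
    obtain ⟨k0, dg, k1, k2⟩ := hg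
    refine ⟨k0.comp h0 hst, dg ∘ (fun p => (f p.1, df p)), fun x hx v => ?_, ?_⟩
    · exact HasDirDeriv.comp ht k1 k2.continuousOn (hst hx) (h1 x hx v)
    · refine ih k2 (BastianiCOn.prodMk ?_ h2) (ht.prod isOpen_univ)
        (fun p hp => ⟨hst hp.1, mem_univ _⟩)
      exact (hf'.comp_clm (ContinuousLinearMap.fst ℝ E E)).mono fun p hp => hp.1

theorem BastianiCOn.of_locally {n : ℕ} {E F : Type*}
    [AddCommGroup E] [Module ℝ E] [TopologicalSpace E] [IsTopologicalAddGroup E]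
    [ContinuousSMul ℝ E]
    [AddCommGroup F] [Module ℝ F] [TopologicalSpace F] [T2Space F] {f : E → F} {s : Set E}
    (hf : ∀ x ∈ s, ∃ t, IsOpen t ∧ x ∈ t ∧ BastianiCOn n f t) : BastianiCOn n f s := by
  classical
  induction n generalizing E F with
  | zero =>
    intro x hx
    obtain ⟨t, ht, hxt, h⟩ := hf x hx
    exact (ContinuousOn.continuousAt h (ht.mem_nhds hxt)).continuousWithinAt
  | succ n ih =>
    have hcont : ContinuousOn f s := fun x hx => by
      obtain ⟨t, ht, hxt, h⟩ := hf x hx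
      exact (ContinuousOn.continuousAt h.1 (ht.mem_nhds hxt)).continuousWithinAt
    let df : E × E → F := fun p =>
      if h : ∃ w, HasDirDeriv f p.1 p.2 w then h.choose else 0
    have hdf : ∀ x h w, HasDirDeriv f x h w → df (x, h) = w := by
      intro x h w hw
      have hex : ∃ w, HasDirDeriv f x h w := ⟨w, hw⟩
      have : df (x, h) = hex.choose := dif_pos hex
      rw [this]
      exact hex.choose_spec.unique hw
    refine ⟨hcont, df, fun x hx h => ?_, ih fun p hp => ?_⟩
    · obtain ⟨t, ht, hxt, -, df', h1, h2⟩ := hf x hx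
      rw [hdf x h _ (h1 x hxt h)]
      exact h1 x hxt h
    · obtain ⟨t, ht, hxt, -, df', h1, h2⟩ := hf p.1 hp.1
      exact ⟨t ×ˢ univ, ht.prod isOpen_univ, ⟨hxt, mem_univ _⟩,
        h2.congr (ht.prod isOpen_univ) fun q hq => (hdf q.1 q.2 _ (h1 q.1 hq.1 q.2)).symm⟩

theorem BastianiCOn.of_isClosedEmbedding_comp {n : ℕ} {E F K : Type*}
    [AddCommGroup E] [Module ℝ E] [TopologicalSpace E] [IsTopologicalAddGroup E]
    [ContinuousSMul ℝ E]
    [AddCommGroup F] [Module ℝ F] [TopologicalSpace F]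
    [AddCommGroup K] [Module ℝ K] [TopologicalSpace K]
    {ι : F →L[ℝ] K} (hι : IsClosedEmbedding ι) {f : E → F} {s : Set E} (hs : IsOpen s)
    (hf : BastianiCOn n (fun x => ι (f x)) s) : BastianiCOn n f s := by
  induction n generalizing E f with
  | zero => exact hι.isInducing.continuousOn_iff.2 hf
  | succ n ih =>
    obtain ⟨h0, df, h1, h2⟩ := hf
    have hex : ∀ x ∈ s, ∀ h, ∃ w, ι w = df (x, h) := fun x hx h => by
      refine hι.isClosed_range.mem_of_tendsto (h1 x hx h) (Eventually.of_forall fun t => ?_)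
      exact ⟨t⁻¹ • (f (x + t • h) - f x), by simp⟩
    choose! w hw using hex
    refine ⟨hι.isInducing.continuousOn_iff.2 h0, fun p => w p.1 p.2, fun x hx h => ?_,
      ih (hs.prod isOpen_univ) ?_⟩
    · refine (hι.isInducing.tendsto_nhds_iff).2 ?_
      rw [hw x hx h]
      refine Tendsto.congr (fun t => ?_) (h1 x hx h)
      simp
    · exact h2.congr (hs.prod isOpen_univ) fun p hp => (hw p.1 hp.1 p.2).symm

/-- Smoothness on a neighborhood of a point. -/
def BastianiSmoothAt {E : Type u} {F : Type v}
    [AddCommGroup E] [Module ℝ E] [TopologicalSpace E]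
    [AddCommGroup F] [Module ℝ F] [TopologicalSpace F]
    (f : E → F) (x : E) : Prop :=
  ∃ t, IsOpen t ∧ x ∈ t ∧ BastianiSmoothOn f t

section At

variable {E F K : Type*}
    [AddCommGroup E] [Module ℝ E] [TopologicalSpace E] [IsTopologicalAddGroup E]
    [ContinuousSMul ℝ E]
    [AddCommGroup F] [Module ℝ F] [TopologicalSpace F] [IsTopologicalAddGroup F]
    [ContinuousSMul ℝ F]
    [AddCommGroup K] [Module ℝ K] [TopologicalSpace K] [IsTopologicalAddGroup K]
    [ContinuousSMul ℝ K]

omit [IsTopologicalAddGroup F] [ContinuousSMul ℝ F] in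
theorem bastianiSmoothOn_iff [T2Space F] {f : E → F} {s : Set E} (hs : IsOpen s) :
    BastianiSmoothOn f s ↔ ∀ x ∈ s, BastianiSmoothAt f x :=
  ⟨fun h x hx => ⟨s, hs, hx, h⟩, fun h n => BastianiCOn.of_locally fun x hx => by
    obtain ⟨t, h1, h2, h3⟩ := h x hx
    exact ⟨t, h1, h2, h3 n⟩⟩

omit [IsTopologicalAddGroup E] [ContinuousSMul ℝ E]
  [IsTopologicalAddGroup F] [ContinuousSMul ℝ F] in
theorem BastianiSmoothAt.continuousAt {f : E → F} {x : E} (hf : BastianiSmoothAt f x) :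
    ContinuousAt f x := by
  obtain ⟨t, h1, h2, h3⟩ := hf
  exact (h3 0).continuousOn.continuousAt (h1.mem_nhds h2)

omit [IsTopologicalAddGroup F] [ContinuousSMul ℝ F] in
theorem BastianiSmoothAt.congr {f g : E → F} {x : E} (hf : BastianiSmoothAt f x)
    (h : f =ᶠ[𝓝 x] g) : BastianiSmoothAt g x := by
  obtain ⟨t, h1, h2, h3⟩ := hf
  obtain ⟨s, hs, hso, hxs⟩ := eventually_nhds_iff.1 h
  exact ⟨t ∩ s, h1.inter hso, ⟨h2, hxs⟩, fun n =>
    ((h3 n).mono inter_subset_left).congr (h1.inter hso) fun y hy => hs y hy.2⟩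

theorem BastianiSmoothAt.comp [LocallyConvexSpace ℝ K] {g : F → K} {f : E → F} {x : E}
    (hg : BastianiSmoothAt g (f x)) (hf : BastianiSmoothAt f x) :
    BastianiSmoothAt (g ∘ f) x := by
  have hcont := hf.continuousAt
  obtain ⟨t, h1, h2, h3⟩ := hg
  obtain ⟨s, hs, hxs, h⟩ := hf
  obtain ⟨r, hr, hro, hxr⟩ := eventually_nhds_iff.1 (hcont.eventually (h1.mem_nhds h2))
  exact ⟨s ∩ r, hs.inter hro, ⟨hxs, hxr⟩, fun n =>
    (h3 n).comp ((h n).mono inter_subset_left) h1 fun y hy => hr y hy.2⟩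

omit [IsTopologicalAddGroup E] [ContinuousSMul ℝ E]
  [IsTopologicalAddGroup F] [ContinuousSMul ℝ F]
  [IsTopologicalAddGroup K] [ContinuousSMul ℝ K] in
theorem BastianiSmoothAt.prodMk {f : E → F} {g : E → K} {x : E}
    (hf : BastianiSmoothAt f x) (hg : BastianiSmoothAt g x) :
    BastianiSmoothAt (fun y => (f y, g y)) x := by
  obtain ⟨t, h1, h2, h3⟩ := hf
  obtain ⟨s, k1, k2, k3⟩ := hg
  exact ⟨t ∩ s, h1.inter k1, ⟨h2, k2⟩, fun n =>
    ((h3 n).mono inter_subset_left).prodMk ((k3 n).mono inter_subset_right)⟩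

omit [IsTopologicalAddGroup E] [ContinuousSMul ℝ E]
  [IsTopologicalAddGroup F] [ContinuousSMul ℝ F] in
theorem ContinuousLinearMap.bastianiSmoothAt (L : E →L[ℝ] F) (x : E) : BastianiSmoothAt L x :=
  ⟨univ, isOpen_univ, mem_univ _, fun n => L.bastianiCOn n _⟩

omit [IsTopologicalAddGroup E] [ContinuousSMul ℝ E]
  [IsTopologicalAddGroup F] [ContinuousSMul ℝ F] in
theorem bastianiSmoothAt_const (a : F) (x : E) : BastianiSmoothAt (fun _ : E => a) x :=
  ⟨univ, isOpen_univ, mem_univ _, fun n => bastianiCOn_const n a _⟩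

omit [IsTopologicalAddGroup E] [ContinuousSMul ℝ E] in
theorem bastianiSmoothAt_id (x : E) : BastianiSmoothAt (fun y : E => y) x :=
  (ContinuousLinearMap.id ℝ E).bastianiSmoothAt x

omit [IsTopologicalAddGroup F] [ContinuousSMul ℝ F]
  [IsTopologicalAddGroup K] [ContinuousSMul ℝ K] in
theorem BastianiSmoothAt.of_isClosedEmbedding_comp {ι : F →L[ℝ] K} (hι : IsClosedEmbedding ι)
    {f : E → F} {x : E} (hf : BastianiSmoothAt (fun y => ι (f y)) x) : BastianiSmoothAt f x := by
  obtain ⟨t, h1, h2, h3⟩ := hf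
  exact ⟨t, h1, h2, fun n => (h3 n).of_isClosedEmbedding_comp hι h1⟩

omit [IsTopologicalAddGroup K] [ContinuousSMul ℝ K] in
/-- Continuous affine maps `y ↦ a + L (y - b)` are smooth. -/
theorem bastianiSmoothAt_affine [LocallyConvexSpace ℝ F] (L : E →L[ℝ] F) (a : F) (b x : E) :
    BastianiSmoothAt (fun y => a + L (y - b)) x := by
  have h := ((ContinuousLinearMap.fst ℝ F F + ContinuousLinearMap.snd ℝ F F).bastianiSmoothAt
    (a - L b, L x)).comp (f := fun y : E => (a - L b, L y))
    ((bastianiSmoothAt_const (a - L b) x).prodMk (L.bastianiSmoothAt x))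
  refine h.congr (Eventually.of_forall fun y => ?_)
  simp only [Function.comp_apply, add_apply, ContinuousLinearMap.coe_fst',
    ContinuousLinearMap.coe_snd', map_sub]
  abel

end At

end Smooth

section Charts

variable {X Y Z : Type*} [TopologicalSpace X] [TopologicalSpace Y] [TopologicalSpace Z]

/-- `f` is smooth at `x` in the charts `c` around `x` and `d` around `f x`. -/
def LCChart.SmoothAt (c : LCChart X) (d : LCChart Y) (f : X → Y) (x : X) : Prop :=
  ContinuousAt f x ∧ BastianiSmoothAt (d.toHomeo ∘ f ∘ c.toHomeo.symm) (c.toHomeo x)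

theorem LCChart.tendsto_symm (c : LCChart X) {x : X} (hx : x ∈ c.toHomeo.source) :
    Tendsto c.toHomeo.symm (𝓝 (c.toHomeo x)) (𝓝 x) := by
  have := c.toHomeo.symm.continuousAt (c.toHomeo.map_source hx)
  rwa [ContinuousAt, c.toHomeo.left_inv hx] at this

theorem LCChart.SmoothAt.congr {c : LCChart X} {d : LCChart Y} {f g : X → Y} {x : X}
    (hf : c.SmoothAt d f x) (hx : x ∈ c.toHomeo.source) (h : f =ᶠ[𝓝 x] g) : c.SmoothAt d g x :=
  ⟨hf.1.congr h, hf.2.congr (((c.tendsto_symm hx).eventually h).mono fun z hz => by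
    simp only [Function.comp_apply, hz])⟩

theorem LCChart.SmoothAt.comp {c : LCChart X} {d : LCChart Y} {e : LCChart Z} {f : X → Y}
    {g : Y → Z} {x : X} (hg : d.SmoothAt e g (f x)) (hf : c.SmoothAt d f x)
    (hx : x ∈ c.toHomeo.source) (hfx : f x ∈ d.toHomeo.source) : c.SmoothAt e (g ∘ f) x := by
  refine ⟨hg.1.comp hf.1, ?_⟩
  have h1 : BastianiSmoothAt (e.toHomeo ∘ g ∘ d.toHomeo.symm)
      ((d.toHomeo ∘ f ∘ c.toHomeo.symm) (c.toHomeo x)) := by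
    simpa only [Function.comp_apply, c.toHomeo.left_inv hx] using hg.2
  refine (h1.comp hf.2).congr ?_
  have h2 := (c.tendsto_symm hx).eventually
    (hf.1.eventually (d.toHomeo.open_source.mem_nhds hfx))
  filter_upwards [h2] with z hz
  simp only [Function.comp_apply, d.toHomeo.left_inv hz]

theorem LCChart.smoothAt_id (c : LCChart X) {x : X} (hx : x ∈ c.toHomeo.source) :
    c.SmoothAt c id x := by
  refine ⟨continuousAt_id, (bastianiSmoothAt_id _).congr ?_⟩
  filter_upwards [c.toHomeo.open_target.mem_nhds (c.toHomeo.map_source hx)] with z hz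
  simp [c.toHomeo.right_inv hz]

theorem LCChart.smoothAt_const (c : LCChart X) (d : LCChart Y) (a : Y) (x : X) :
    c.SmoothAt d (fun _ => a) x :=
  ⟨continuousAt_const, bastianiSmoothAt_const (d.toHomeo a) _⟩

theorem LCChart.SmoothAt.prodMk {c : LCChart X} {d : LCChart Y} {e : LCChart Z} {f : X → Y}
    {g : X → Z} {x : X} (hf : c.SmoothAt d f x) (hg : c.SmoothAt e g x) :
    c.SmoothAt (d.prod e) (fun y => (f y, g y)) x :=
  ⟨hf.1.prodMk hg.1, hf.2.prodMk hg.2⟩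

theorem LCChart.smoothAt_fst (c : LCChart X) (d : LCChart Y) {p : X × Y}
    (hp : p ∈ (c.prod d).toHomeo.source) : (c.prod d).SmoothAt c Prod.fst p := by
  refine ⟨continuousAt_fst, ((ContinuousLinearMap.fst ℝ c.E d.E).bastianiSmoothAt _).congr ?_⟩
  filter_upwards [(c.prod d).toHomeo.open_target.mem_nhds
    ((c.prod d).toHomeo.map_source hp)] with z hz
  exact (c.toHomeo.right_inv hz.1).symm

theorem LCChart.smoothAt_snd (c : LCChart X) (d : LCChart Y) {p : X × Y}
    (hp : p ∈ (c.prod d).toHomeo.source) : (c.prod d).SmoothAt d Prod.snd p := by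
  refine ⟨continuousAt_snd, ((ContinuousLinearMap.snd ℝ c.E d.E).bastianiSmoothAt _).congr ?_⟩
  filter_upwards [(c.prod d).toHomeo.open_target.mem_nhds
    ((c.prod d).toHomeo.map_source hp)] with z hz
  exact (d.toHomeo.right_inv hz.2).symm

theorem bastianiSmoothOn_charts_iff {c : LCChart X} {d : LCChart Y} {f : X → Y} {s : Set X}
    (hs : IsOpen s) (hf : ContinuousOn f s) :
    BastianiSmoothOn (d.toHomeo ∘ f ∘ c.toHomeo.symm)
      (c.toHomeo.target ∩ c.toHomeo.symm ⁻¹' (s ∩ f ⁻¹' d.toHomeo.source)) ↔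
    ∀ x ∈ s, x ∈ c.toHomeo.source → f x ∈ d.toHomeo.source → c.SmoothAt d f x := by
  have ho : IsOpen (s ∩ f ⁻¹' d.toHomeo.source) := hf.isOpen_inter_preimage hs d.toHomeo.open_source
  have ho' : IsOpen (c.toHomeo.target ∩ c.toHomeo.symm ⁻¹' (s ∩ f ⁻¹' d.toHomeo.source)) :=
    c.toHomeo.symm.isOpen_inter_preimage ho
  rw [bastianiSmoothOn_iff ho']
  constructor
  · intro h x hx hxc hxd
    refine ⟨hf.continuousAt (hs.mem_nhds hx), h _ ⟨c.toHomeo.map_source hxc, ?_⟩⟩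
    simpa only [mem_preimage, c.toHomeo.left_inv hxc] using ⟨hx, hxd⟩
  · rintro h z ⟨hz, hz'⟩
    have := (h _ hz'.1 (c.toHomeo.map_target hz) hz'.2).2
    rwa [c.toHomeo.right_inv hz] at this

theorem LCChart.compatible_iff {c d : LCChart X} : c.Compatible d ↔
    ∀ x ∈ c.toHomeo.source, x ∈ d.toHomeo.source → c.SmoothAt d id x ∧ d.SmoothAt c id x := by
  have h1 := bastianiSmoothOn_charts_iff (c := c) (d := d) (f := id) isOpen_univ continuousOn_id
  have h2 := bastianiSmoothOn_charts_iff (c := d) (d := c) (f := id) isOpen_univ continuousOn_id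
  simp only [univ_inter, preimage_id, Function.id_comp] at h1 h2
  rw [LCChart.Compatible, h1, h2]
  exact ⟨fun h x hc hd => ⟨h.1 x trivial hc hd, h.2 x trivial hd hc⟩,
    fun h => ⟨fun x _ hc hd => (h x hc hd).1, fun x _ hd hc => (h x hc hd).2⟩⟩

/-- The charts of `A` cover the space and are pairwise compatible. -/
structure IsSmoothAtlas (A : Set (LCChart X)) : Prop where
  cover : ∀ x, ∃ c ∈ A, x ∈ c.toHomeo.source
  compatible : ∀ c ∈ A, ∀ d ∈ A, c.Compatible d

theorem SmoothStructure.isSmoothAtlas (𝒮 : SmoothStructure X) : IsSmoothAtlas 𝒮.atlas :=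
  ⟨𝒮.cover, 𝒮.compatible⟩

theorem IsSmoothAtlas.smoothAt_id {A : Set (LCChart X)} (hA : IsSmoothAtlas A) {c d : LCChart X}
    (hc : c ∈ A) (hd : d ∈ A) {x : X} (hxc : x ∈ c.toHomeo.source)
    (hxd : x ∈ d.toHomeo.source) : c.SmoothAt d id x :=
  (LCChart.compatible_iff.1 (hA.compatible c hc d hd) x hxc hxd).1

/-- Smoothness at a point of a map between manifolds given by atlases. -/
def SmoothMapAt (A : Set (LCChart X)) (B : Set (LCChart Y)) (f : X → Y) (x : X) : Prop :=
  ContinuousAt f x ∧ ∀ c ∈ A, ∀ d ∈ B, x ∈ c.toHomeo.source → f x ∈ d.toHomeo.source →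
    c.SmoothAt d f x

theorem smoothMapOn_iff {A : Set (LCChart X)} {B : Set (LCChart Y)} {f : X → Y} {s : Set X}
    (hs : IsOpen s) : SmoothMapOn A B f s ↔ ∀ x ∈ s, SmoothMapAt A B f x := by
  constructor
  · intro h x hx
    exact ⟨h.1.continuousAt (hs.mem_nhds hx), fun c hc d hd =>
      (bastianiSmoothOn_charts_iff hs h.1).1 (h.2 c hc d hd) x hx⟩
  · intro h
    have hc : ContinuousOn f s := fun x hx => (h x hx).1.continuousWithinAt
    exact ⟨hc, fun c hcA d hd => (bastianiSmoothOn_charts_iff hs hc).2 fun x hx =>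
      (h x hx).2 c hcA d hd⟩

theorem LCChart.SmoothAt.smoothMapAt {A : Set (LCChart X)} {B : Set (LCChart Y)}
    (hA : IsSmoothAtlas A) (hB : IsSmoothAtlas B) {f : X → Y} {x : X} {c : LCChart X}
    {d : LCChart Y} (hc : c ∈ A) (hd : d ∈ B) (hx : x ∈ c.toHomeo.source)
    (hfx : f x ∈ d.toHomeo.source) (h : c.SmoothAt d f x) : SmoothMapAt A B f x :=
  ⟨h.1, fun _ hc' _ hd' hxc hxd =>
    ((hB.smoothAt_id hd hd' hfx hxd).comp (g := id) h hx hfx).comp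
      (f := id) (hA.smoothAt_id hc' hc hxc hx) hxc hx⟩

theorem SmoothMapAt.comp {A : Set (LCChart X)} {B : Set (LCChart Y)} {C : Set (LCChart Z)}
    (hB : IsSmoothAtlas B) {f : X → Y} {g : Y → Z} {x : X}
    (hg : SmoothMapAt B C g (f x)) (hf : SmoothMapAt A B f x) : SmoothMapAt A C (g ∘ f) x := by
  obtain ⟨b, hb, hxb⟩ := hB.cover (f x)
  exact ⟨hg.1.comp hf.1, fun c hc d hd hxc hxd =>
    (hg.2 b hb d hd hxb hxd).comp (hf.2 c hc b hb hxc hxb) hxc hxb⟩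

theorem SmoothMapAt.congr {A : Set (LCChart X)} {B : Set (LCChart Y)} {f g : X → Y} {x : X}
    (hf : SmoothMapAt A B f x) (h : f =ᶠ[𝓝 x] g) : SmoothMapAt A B g x :=
  ⟨hf.1.congr h, fun c hc d hd hxc hxd =>
    (hf.2 c hc d hd hxc (by rwa [h.self_of_nhds])).congr hxc h⟩

theorem IsSmoothAtlas.mem_maximalAtlas {A : Set (LCChart X)} (hA : IsSmoothAtlas A)
    {c : LCChart X} (hc : c ∈ A) : c ∈ maximalAtlas A :=
  fun d hd => hA.compatible c hc d hd

theorem IsSmoothAtlas.maximalAtlas {A : Set (LCChart X)} (hA : IsSmoothAtlas A) :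
    IsSmoothAtlas (maximalAtlas A) where
  cover x := by
    obtain ⟨c, hc, hx⟩ := hA.cover x
    exact ⟨c, hA.mem_maximalAtlas hc, hx⟩
  compatible c hc d hd := by
    rw [LCChart.compatible_iff]
    intro x hxc hxd
    obtain ⟨b, hb, hxb⟩ := hA.cover x
    have h1 := LCChart.compatible_iff.1 (hc b hb) x hxc hxb
    have h2 := LCChart.compatible_iff.1 (hd b hb) x hxd hxb
    exact ⟨h2.2.comp (f := id) h1.1 hxc hxb, h1.2.comp (f := id) h2.1 hxd hxb⟩

theorem SmoothMapAt.maximalAtlas {A : Set (LCChart X)} {B : Set (LCChart Y)}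
    (hA : IsSmoothAtlas A) (hB : IsSmoothAtlas B) {f : X → Y} {x : X}
    (h : SmoothMapAt A B f x) : SmoothMapAt (maximalAtlas A) (maximalAtlas B) f x := by
  obtain ⟨c, hc, hx⟩ := hA.cover x
  obtain ⟨d, hd, hfx⟩ := hB.cover (f x)
  exact (h.2 c hc d hd hx hfx).smoothMapAt hA.maximalAtlas hB.maximalAtlas
    (hA.mem_maximalAtlas hc) (hB.mem_maximalAtlas hd) hx hfx

theorem SmoothStructure.maximalAtlas_eq (𝒮 : SmoothStructure X) :
    maximalAtlas 𝒮.atlas = 𝒮.atlas :=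
  Subset.antisymm (fun c hc => 𝒮.maximal c hc) fun _ hc => 𝒮.isSmoothAtlas.mem_maximalAtlas hc

/-- The smooth structure generated by a smooth atlas. -/
def IsSmoothAtlas.toSmoothStructure {A : Set (LCChart X)} (hA : IsSmoothAtlas A) :
    SmoothStructure X where
  atlas := _root_.maximalAtlas A
  cover := hA.maximalAtlas.cover
  compatible := hA.maximalAtlas.compatible
  maximal _ hc := fun d hd => hc d (hA.mem_maximalAtlas hd)

theorem IsSmoothAtlas.prodAtlas {A : Set (LCChart X)} {B : Set (LCChart Y)}
    (hA : IsSmoothAtlas A) (hB : IsSmoothAtlas B) : IsSmoothAtlas (prodAtlas A B) where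
  cover p := by
    obtain ⟨c, hc, hx⟩ := hA.cover p.1
    obtain ⟨d, hd, hy⟩ := hB.cover p.2
    exact ⟨c.prod d, ⟨c, hc, d, hd, rfl⟩, hx, hy⟩
  compatible := by
    have key : ∀ c ∈ A, ∀ d ∈ B, ∀ c' ∈ A, ∀ d' ∈ B, ∀ p ∈ (c.prod d).toHomeo.source,
        p ∈ (c'.prod d').toHomeo.source → (c.prod d).SmoothAt (c'.prod d') id p := by
      intro c hc d hd c' hc' d' hd' p hp hp'
      exact ((hA.smoothAt_id hc hc' hp.1 hp'.1).comp (c.smoothAt_fst d hp) hp hp.1).prodMk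
        ((hB.smoothAt_id hd hd' hp.2 hp'.2).comp (c.smoothAt_snd d hp) hp hp.2)
    rintro _ ⟨c, hc, d, hd, rfl⟩ _ ⟨c', hc', d', hd', rfl⟩
    rw [LCChart.compatible_iff]
    exact fun p hp hp' => ⟨key c hc d hd c' hc' d' hd' p hp hp', key c' hc' d' hd' c hc d hd p hp' hp⟩

theorem SmoothMapAt.partial_snd {A : Set (LCChart X)} {B : Set (LCChart Y)} {C : Set (LCChart Z)}
    (hA : IsSmoothAtlas A) {f : X × Y → Z} {a : X} {y : Y}
    (h : SmoothMapAt (prodAtlas A B) C f (a, y)) : SmoothMapAt B C (fun y => f (a, y)) y := by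
  obtain ⟨c, hc, ha⟩ := hA.cover a
  refine ⟨h.1.comp (f := fun y => (a, y)) (Continuous.continuousAt (by fun_prop)),
    fun d hd e he hy hfy => ?_⟩
  exact (h.2 (c.prod d) ⟨c, hc, d, hd, rfl⟩ e he ⟨ha, hy⟩ hfy).comp (f := fun y => (a, y))
    ((d.smoothAt_const c a y).prodMk (d.smoothAt_id hy)) hy ⟨ha, hy⟩

end Charts

section Submanifold

variable {X : Type u} [TopologicalSpace X] {Y : Type v} [TopologicalSpace Y]

/-- `c` is the chart of `N` given by the chart `φ` of `X` and the linear embedding `ι`. -/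
structure IsRestrictedChart {N : Set X} (φ : LCChart X) (c : LCChart N) (ι : c.E →L[ℝ] φ.E) :
    Prop where
  isClosedEmbedding : IsClosedEmbedding ι
  image_eq : φ.toHomeo '' (φ.toHomeo.source ∩ N) = φ.toHomeo.target ∩ range ι
  source_eq : c.toHomeo.source = Subtype.val ⁻¹' φ.toHomeo.source
  apply_eq : ∀ x ∈ c.toHomeo.source, ι (c.toHomeo x) = φ.toHomeo x

theorem mem_subAtlas_iff {A : Set (LCChart X)} {N : Set X} {c : LCChart N} :
    c ∈ subAtlas A N ↔ ∃ φ ∈ A, ∃ ι, IsRestrictedChart φ c ι :=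
  ⟨fun ⟨φ, hφ, ι, h1, h2, h3, h4⟩ => ⟨φ, hφ, ι, h1, h2, h3, h4⟩,
    fun ⟨φ, hφ, ι, h1, h2, h3, h4⟩ => ⟨φ, hφ, ι, h1, h2, h3, h4⟩⟩

namespace IsRestrictedChart

variable {N : Set X} {φ : LCChart X} {c : LCChart N} {ι : c.E →L[ℝ] φ.E}

theorem mem_source_iff (h : IsRestrictedChart φ c ι) {x : N} :
    x ∈ c.toHomeo.source ↔ (x : X) ∈ φ.toHomeo.source := by
  rw [h.source_eq, mem_preimage]

theorem smoothAt_val (h : IsRestrictedChart φ c ι) {x : N} (hx : x ∈ c.toHomeo.source) :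
    c.SmoothAt φ Subtype.val x := by
  refine ⟨continuousAt_subtype_val, (ι.bastianiSmoothAt _).congr ?_⟩
  filter_upwards [c.toHomeo.open_target.mem_nhds (c.toHomeo.map_source hx)] with z hz
  simp only [Function.comp_apply, ← h.apply_eq _ (c.toHomeo.map_target hz),
    c.toHomeo.right_inv hz]

theorem smoothAt_of_val (h : IsRestrictedChart φ c ι) {e : LCChart Y} {f : Y → N} {y : Y}
    (hy : y ∈ e.toHomeo.source) (hfy : f y ∈ c.toHomeo.source)
    (hf : e.SmoothAt φ (fun z => (f z : X)) y) : e.SmoothAt c f y := by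
  have hcont : ContinuousAt f y := IsInducing.subtypeVal.continuousAt_iff.2 hf.1
  refine ⟨hcont, BastianiSmoothAt.of_isClosedEmbedding_comp h.isClosedEmbedding
    (hf.2.congr ?_)⟩
  have h2 := (e.tendsto_symm hy).eventually
    (hcont.eventually (c.toHomeo.open_source.mem_nhds hfy))
  filter_upwards [h2] with z hz
  simp only [Function.comp_apply, h.apply_eq _ hz]

end IsRestrictedChart

theorem IsSubmanifold.isSmoothAtlas {A : Set (LCChart X)} (hA : IsSmoothAtlas A) {N : Set X}
    (hN : IsSubmanifold A N) : IsSmoothAtlas (subAtlas A N) where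
  cover := hN
  compatible := by
    have key : ∀ c ∈ subAtlas A N, ∀ d ∈ subAtlas A N, ∀ x ∈ c.toHomeo.source,
        x ∈ d.toHomeo.source → c.SmoothAt d id x := by
      intro c hc d hd x hxc hxd
      obtain ⟨φ, hφ, ι, h⟩ := mem_subAtlas_iff.1 hc
      obtain ⟨ψ, hψ, κ, k⟩ := mem_subAtlas_iff.1 hd
      have h1 := hA.smoothAt_id hφ hψ (h.mem_source_iff.1 hxc) (k.mem_source_iff.1 hxd)
      exact k.smoothAt_of_val hxc hxd
        (h1.comp (f := Subtype.val) (h.smoothAt_val hxc) hxc (h.mem_source_iff.1 hxc))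
    intro c hc d hd
    rw [LCChart.compatible_iff]
    exact fun x hxc hxd => ⟨key c hc d hd x hxc hxd, key d hd c hc x hxd hxc⟩

theorem IsSubmanifold.smoothMapAt_val {A : Set (LCChart X)} (hA : IsSmoothAtlas A) {N : Set X}
    (hN : IsSubmanifold A N) (x : N) : SmoothMapAt (subAtlas A N) A Subtype.val x := by
  obtain ⟨c, hc, hx⟩ := hN x
  obtain ⟨φ, hφ, ι, h⟩ := mem_subAtlas_iff.1 hc
  exact (h.smoothAt_val hx).smoothMapAt (hN.isSmoothAtlas hA) hA hc hφ hx (h.mem_source_iff.1 hx)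

theorem SmoothMapAt.of_val {A : Set (LCChart X)} {N : Set X} {B : Set (LCChart Y)} {f : Y → N}
    {y : Y} (h : SmoothMapAt B A (fun z => (f z : X)) y) : SmoothMapAt B (subAtlas A N) f y := by
  refine ⟨IsInducing.subtypeVal.continuousAt_iff.2 h.1, fun e he c hc hy hfy => ?_⟩
  obtain ⟨φ, hφ, ι, hc⟩ := mem_subAtlas_iff.1 hc
  exact hc.smoothAt_of_val hy hfy (h.2 e he φ hφ hy (hc.mem_source_iff.1 hfy))

theorem SmoothMapAt.restrict {A : Set (LCChart X)} (hA : IsSmoothAtlas A) {N : Set X}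
    (hN : IsSubmanifold A N) {f : X → X} (hf : MapsTo f N N) {x : N} (h : SmoothMapAt A A f x) :
    SmoothMapAt (subAtlas A N) (subAtlas A N) (hf.restrict f N N) x :=
  SmoothMapAt.of_val (h.comp (f := Subtype.val) hA (hN.smoothMapAt_val hA x))

/-- The chart of `N` given by a chart of `X` and a closed linear embedding `ι`. -/
noncomputable def LCChart.restrict (φ : LCChart X) (N : Set X) (x₀ : N) {F : Type u}
    [AddCommGroup F] [Module ℝ F] [TopologicalSpace F] [IsTopologicalAddGroup F]
    [ContinuousSMul ℝ F] [LocallyConvexSpace ℝ F] [T2Space F] (ι : F →L[ℝ] φ.E)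
    (hι : IsClosedEmbedding ι)
    (h : φ.toHomeo '' (φ.toHomeo.source ∩ N) = φ.toHomeo.target ∩ range ι) : LCChart N := by
  classical
  have hmem : ∀ z, ι z ∈ φ.toHomeo.target → φ.toHomeo.symm (ι z) ∈ N := fun z hz => by
    obtain ⟨x, hx, hxz⟩ := h.ge ⟨hz, mem_range_self z⟩
    rw [← hxz, φ.toHomeo.left_inv hx.1]
    exact hx.2
  have hinv : ∀ x : N, (x : X) ∈ φ.toHomeo.source →
      ι (Function.invFun ι (φ.toHomeo x)) = φ.toHomeo x := fun x hx =>
    Function.invFun_eq (h.le ⟨x, ⟨hx, x.2⟩, rfl⟩).2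
  exact
  { E := F
    toHomeo :=
    { toFun := fun x => Function.invFun ι (φ.toHomeo x)
      invFun := fun z => if hz : ι z ∈ φ.toHomeo.target then ⟨_, hmem z hz⟩ else x₀
      source := Subtype.val ⁻¹' φ.toHomeo.source
      target := ι ⁻¹' φ.toHomeo.target
      map_source' := fun x hx => by
        rw [mem_preimage, hinv x hx]
        exact φ.toHomeo.map_source hx
      map_target' := fun z hz => by
        have hz' : ι z ∈ φ.toHomeo.target := hz
        rw [dif_pos hz']
        exact φ.toHomeo.map_target hz
      left_inv' := fun x hx => by
        have hx' : ι (Function.invFun ι (φ.toHomeo x)) ∈ φ.toHomeo.target := by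
          rw [hinv x hx]
          exact φ.toHomeo.map_source hx
        rw [dif_pos hx']
        ext
        simp only [hinv x hx]
        exact φ.toHomeo.left_inv hx
      right_inv' := fun z hz => by
        have hz' : ι z ∈ φ.toHomeo.target := hz
        rw [dif_pos hz']
        simp only [φ.toHomeo.right_inv hz']
        exact Function.leftInverse_invFun hι.injective z
      open_source := φ.toHomeo.open_source.preimage continuous_subtype_val
      open_target := φ.toHomeo.open_target.preimage ι.continuous
      continuousOn_toFun := by
        rw [hι.isInducing.continuousOn_iff]
        refine ContinuousOn.congr (f := fun x : N => φ.toHomeo x)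
          (φ.toHomeo.continuousOn.comp continuous_subtype_val.continuousOn fun x hx => hx) ?_
        exact fun x hx => hinv x hx
      continuousOn_invFun := by
        rw [IsInducing.subtypeVal.continuousOn_iff]
        refine ContinuousOn.congr (f := fun z => φ.toHomeo.symm (ι z))
          (φ.toHomeo.symm.continuousOn.comp ι.continuous.continuousOn fun x hx => hx) ?_
        intro z hz
        have hz' : ι z ∈ φ.toHomeo.target := hz
        simp only [Function.comp_apply, dif_pos hz'] } }

theorem LCChart.isRestrictedChart_restrict (φ : LCChart X) (N : Set X) (x₀ : N) {F : Type u}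
    [AddCommGroup F] [Module ℝ F] [TopologicalSpace F] [IsTopologicalAddGroup F]
    [ContinuousSMul ℝ F] [LocallyConvexSpace ℝ F] [T2Space F] (ι : F →L[ℝ] φ.E)
    (hι : IsClosedEmbedding ι)
    (h : φ.toHomeo '' (φ.toHomeo.source ∩ N) = φ.toHomeo.target ∩ range ι) :
    IsRestrictedChart φ (φ.restrict N x₀ ι hι h) ι :=
  ⟨hι, h, rfl, fun x hx => Function.invFun_eq (h.le ⟨x, ⟨hx, x.2⟩, rfl⟩).2⟩

end Submanifold

section Submersions

variable {X Y : Type*} [TopologicalSpace X] [TopologicalSpace Y]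

/-- Through every point of the domain of `f` there is a smooth local section of `f`. -/
def HasSmoothSections (A : Set (LCChart X)) (B : Set (LCChart Y)) (f : X → Y) : Prop :=
  ∀ x, ∃ σ : Y → X, SmoothMapAt B A σ (f x) ∧ σ (f x) = x ∧ ∀ᶠ y in 𝓝 (f x), f (σ y) = y

/-- A map given in charts by a continuous linear projection has smooth local sections. -/
theorem LCChart.exists_smooth_section {c : LCChart X} {d : LCChart Y} {f : X → Y}
    (hf : MapsTo f c.toHomeo.source d.toHomeo.source) {p : c.E →L[ℝ] d.E} {σ : d.E →L[ℝ] c.E}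
    (hσ : ∀ z, p (σ z) = z) (hp : ∀ y ∈ c.toHomeo.source, d.toHomeo (f y) = p (c.toHomeo y))
    {x : X} (hx : x ∈ c.toHomeo.source) :
    ∃ τ : Y → X, d.SmoothAt c τ (f x) ∧ τ (f x) = x ∧ ∀ᶠ y in 𝓝 (f x), f (τ y) = y := by
  set g : d.E → c.E := fun z => c.toHomeo x + σ (z - p (c.toHomeo x)) with hg
  have hgs : BastianiSmoothAt g (d.toHomeo (f x)) := bastianiSmoothAt_affine _ _ _ _
  have hgx : g (d.toHomeo (f x)) = c.toHomeo x := by simp [hg, hp x hx]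
  have hdx := hf hx
  have hgt : ∀ᶠ z in 𝓝 (d.toHomeo (f x)), g z ∈ c.toHomeo.target := by
    have := hgs.continuousAt
    rw [ContinuousAt, hgx] at this
    exact this.eventually (c.toHomeo.open_target.mem_nhds (c.toHomeo.map_source hx))
  have hd := d.toHomeo.continuousAt hdx
  have hτx : c.toHomeo.symm (g (d.toHomeo (f x))) = x := by rw [hgx, c.toHomeo.left_inv hx]
  refine ⟨fun y => c.toHomeo.symm (g (d.toHomeo y)), ⟨?_, hgs.congr ?_⟩, hτx, ?_⟩
  · rw [ContinuousAt, hτx]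
    have h1 := hgs.continuousAt
    rw [ContinuousAt, hgx] at h1
    exact (c.tendsto_symm hx).comp (h1.comp hd)
  · filter_upwards [hgt, d.toHomeo.open_target.mem_nhds (d.toHomeo.map_source hdx)] with z hz hz'
    simp only [Function.comp_apply, d.toHomeo.right_inv hz', c.toHomeo.right_inv hz]
  · filter_upwards [hd.eventually hgt, d.toHomeo.open_source.mem_nhds hdx] with y hy hy'
    refine d.toHomeo.injOn (hf (c.toHomeo.map_target hy)) hy' ?_
    rw [hp _ (c.toHomeo.map_target hy), c.toHomeo.right_inv hy]
    simp [hg, hσ]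

theorem IsSubmersion.hasSmoothSections {A : Set (LCChart X)} {B : Set (LCChart Y)}
    (hA : IsSmoothAtlas A) (hB : IsSmoothAtlas B) {f : X → Y} (hf : IsSubmersion A B f) :
    HasSmoothSections A B f := by
  intro x
  obtain ⟨c, hc, d, hd, hx, hm, p, σ, hσ, hp⟩ := hf.2 x
  obtain ⟨τ, h1, h2, h3⟩ := LCChart.exists_smooth_section hm hσ hp hx
  have h4 : SmoothMapAt (maximalAtlas B) (maximalAtlas A) τ (f x) :=
    h1.smoothMapAt hB.maximalAtlas hA.maximalAtlas hd hc (hm hx) (by rwa [h2])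
  exact ⟨τ, ⟨h4.1, fun d hd c hc => h4.2 d (hB.mem_maximalAtlas hd) c (hA.mem_maximalAtlas hc)⟩,
    h2, h3⟩

theorem IsSubmersion.smoothMapAt {A : Set (LCChart X)} {B : Set (LCChart Y)} {f : X → Y}
    (hf : IsSubmersion A B f) (x : X) : SmoothMapAt A B f x :=
  (smoothMapOn_iff isOpen_univ).1 hf.1 x (mem_univ x)

theorem HasSmoothSections.isOpenMap {A : Set (LCChart X)} {B : Set (LCChart Y)} {f : X → Y}
    (hf : HasSmoothSections A B f) : IsOpenMap f := by
  rw [isOpenMap_iff_nhds_le]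
  intro x s hs
  obtain ⟨τ, h1, h2, h3⟩ := hf x
  have h4 := h1.1
  rw [ContinuousAt, h2] at h4
  filter_upwards [h4.eventually hs, h3] with y hy hy'
  rwa [hy'] at hy

end Submersions

section Quotient

variable {N Q : Type u} [TopologicalSpace N]

/-- A chart of `N` in which the fibres of `π` are the fibres of a linear projection. -/
structure AdaptedChart (π : N → Q) where
  chart : LCChart N
  base : N
  base_mem : base ∈ chart.toHomeo.source
  F : Type u
  [addCommGroup : AddCommGroup F]
  [module : Module ℝ F]
  [topology : TopologicalSpace F]
  [isTopologicalAddGroup : IsTopologicalAddGroup F]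
  [continuousSMul : ContinuousSMul ℝ F]
  [locallyConvexSpace : LocallyConvexSpace ℝ F]
  [t2Space : T2Space F]
  p : chart.E →L[ℝ] F
  σ : F →L[ℝ] chart.E
  p_σ : ∀ z, p (σ z) = z
  eq_iff : ∀ y ∈ chart.toHomeo.source, ∀ y' ∈ chart.toHomeo.source,
    π y = π y' ↔ p (chart.toHomeo y) = p (chart.toHomeo y')

attribute [instance] AdaptedChart.addCommGroup AdaptedChart.module AdaptedChart.topology
  AdaptedChart.isTopologicalAddGroup AdaptedChart.continuousSMul AdaptedChart.locallyConvexSpace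
  AdaptedChart.t2Space

namespace AdaptedChart

variable {π : N → Q} (a : AdaptedChart π)

open Classical in
/-- The coordinates on the quotient. -/
noncomputable def coord (q : Q) : a.F :=
  if h : ∃ y ∈ a.chart.toHomeo.source, π y = q then a.p (a.chart.toHomeo h.choose) else 0

open Classical in
/-- The inverse of the coordinates on the quotient. -/
noncomputable def coordInv (z : a.F) : Q :=
  if h : ∃ w ∈ a.chart.toHomeo.target, a.p w = z then π (a.chart.toHomeo.symm h.choose)
  else π a.base

theorem coord_apply {y : N} (hy : y ∈ a.chart.toHomeo.source) :
    a.coord (π y) = a.p (a.chart.toHomeo y) := by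
  have h : ∃ y' ∈ a.chart.toHomeo.source, π y' = π y := ⟨y, hy, rfl⟩
  rw [coord, dif_pos h]
  exact (a.eq_iff _ h.choose_spec.1 _ hy).1 h.choose_spec.2

theorem coordInv_apply {w : a.chart.E} (hw : w ∈ a.chart.toHomeo.target) :
    a.coordInv (a.p w) = π (a.chart.toHomeo.symm w) := by
  have h : ∃ w' ∈ a.chart.toHomeo.target, a.p w' = a.p w := ⟨w, hw, rfl⟩
  rw [coordInv, dif_pos h, a.eq_iff _ (a.chart.toHomeo.map_target h.choose_spec.1) _
    (a.chart.toHomeo.map_target hw), a.chart.toHomeo.right_inv hw,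
    a.chart.toHomeo.right_inv h.choose_spec.1]
  exact h.choose_spec.2

theorem isOpenQuotientMap_p : IsOpenQuotientMap a.p where
  surjective z := ⟨a.σ z, a.p_σ z⟩
  continuous := a.p.continuous
  isOpenMap := IsOpenMap.of_sections fun w =>
    ⟨fun z => w + a.σ (z - a.p w), Continuous.continuousAt (by fun_prop), by simp,
      fun z => by simp [a.p_σ]⟩

variable [TopologicalSpace Q]

/-- The chart of the quotient given by an adapted chart. -/
noncomputable def quotientChart (hπ : IsOpenQuotientMap π) : LCChart Q where
  E := a.F
  toHomeo :=
  { toFun := a.coord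
    invFun := a.coordInv
    source := π '' a.chart.toHomeo.source
    target := a.p '' a.chart.toHomeo.target
    map_source' := by
      rintro _ ⟨y, hy, rfl⟩
      rw [a.coord_apply hy]
      exact mem_image_of_mem _ (a.chart.toHomeo.map_source hy)
    map_target' := by
      rintro _ ⟨w, hw, rfl⟩
      rw [a.coordInv_apply hw]
      exact mem_image_of_mem _ (a.chart.toHomeo.map_target hw)
    left_inv' := by
      rintro _ ⟨y, hy, rfl⟩
      rw [a.coord_apply hy, a.coordInv_apply (a.chart.toHomeo.map_source hy),
        a.chart.toHomeo.left_inv hy]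
    right_inv' := by
      rintro _ ⟨w, hw, rfl⟩
      rw [a.coordInv_apply hw, a.coord_apply (a.chart.toHomeo.map_target hw),
        a.chart.toHomeo.right_inv hw]
    open_source := hπ.isOpenMap _ a.chart.toHomeo.open_source
    open_target := a.isOpenQuotientMap_p.isOpenMap _ a.chart.toHomeo.open_target
    continuousOn_toFun := by
      rintro _ ⟨y, hy, rfl⟩
      refine ContinuousAt.continuousWithinAt ?_
      rw [← hπ.continuousAt_comp_iff]
      refine (a.p.continuous.continuousAt.comp (a.chart.toHomeo.continuousAt hy)).congr ?_
      filter_upwards [a.chart.toHomeo.open_source.mem_nhds hy] with y' hy'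
      exact (a.coord_apply hy').symm
    continuousOn_invFun := by
      rintro _ ⟨w, hw, rfl⟩
      refine ContinuousAt.continuousWithinAt ?_
      rw [← a.isOpenQuotientMap_p.continuousAt_comp_iff]
      refine (hπ.continuous.continuousAt.comp (a.chart.toHomeo.symm.continuousAt hw)).congr ?_
      filter_upwards [a.chart.toHomeo.open_target.mem_nhds hw] with y' hy'
      exact (a.coordInv_apply hy').symm }

theorem smoothAt_proj (hπ : IsOpenQuotientMap π) {y : N} (hy : y ∈ a.chart.toHomeo.source) :
    a.chart.SmoothAt (a.quotientChart hπ) π y := by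
  refine ⟨hπ.continuous.continuousAt, (a.p.bastianiSmoothAt _).congr ?_⟩
  filter_upwards [a.chart.toHomeo.open_target.mem_nhds (a.chart.toHomeo.map_source hy)] with z hz
  refine Eq.trans ?_ (a.coord_apply (a.chart.toHomeo.map_target hz)).symm
  rw [a.chart.toHomeo.right_inv hz]

theorem exists_section (hπ : IsOpenQuotientMap π) {y : N} (hy : y ∈ a.chart.toHomeo.source) :
    ∃ τ : Q → N, (a.quotientChart hπ).SmoothAt a.chart τ (π y) ∧ τ (π y) = y ∧
      ∀ᶠ q in 𝓝 (π y), π (τ q) = q :=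
  LCChart.exists_smooth_section (d := a.quotientChart hπ) (p := a.p) (σ := a.σ)
    (fun _ hx => mem_image_of_mem _ hx) a.p_σ (fun _ hy => a.coord_apply hy) hy

end AdaptedChart

/-- The charts of the quotient given by the adapted charts in `A`. -/
def quotientAtlas [TopologicalSpace Q] (A : Set (LCChart N)) {π : N → Q}
    (hπ : IsOpenQuotientMap π) : Set (LCChart Q) :=
  {d | ∃ a : AdaptedChart π, a.chart ∈ A ∧ d = a.quotientChart hπ}

theorem isSmoothAtlas_quotientAtlas [TopologicalSpace Q] {A : Set (LCChart N)} {π : N → Q}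
    (hπ : IsOpenQuotientMap π)
    (ha : ∀ x, ∃ a : AdaptedChart π, a.chart ∈ A ∧ x ∈ a.chart.toHomeo.source)
    (hγ : ∀ x x', π x = π x' → ∃ γ : N → N, (∀ y, SmoothMapAt A A γ y) ∧ γ x = x' ∧
      ∀ y, π (γ y) = π y) : IsSmoothAtlas (quotientAtlas A hπ) where
  cover q := by
    obtain ⟨x, rfl⟩ := hπ.surjective q
    obtain ⟨a, haA, hx⟩ := ha x
    exact ⟨_, ⟨a, haA, rfl⟩, mem_image_of_mem _ hx⟩
  compatible := by
    have key : ∀ a b : AdaptedChart π, a.chart ∈ A → b.chart ∈ A →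
        ∀ q ∈ (a.quotientChart hπ).toHomeo.source, q ∈ (b.quotientChart hπ).toHomeo.source →
        (a.quotientChart hπ).SmoothAt (b.quotientChart hπ) id q := by
      rintro a b haA hbA _ ⟨y, hy, rfl⟩ ⟨y', hy', hyy⟩
      obtain ⟨γ, hγ1, hγ2, hγ3⟩ := hγ y y' hyy.symm
      obtain ⟨τ, h1, h2, h3⟩ := a.exists_section hπ hy
      have hq : π y ∈ (a.quotientChart hπ).toHomeo.source := mem_image_of_mem _ hy
      have hτ : τ (π y) ∈ a.chart.toHomeo.source := by rwa [h2]
      have hγτ : γ (τ (π y)) ∈ b.chart.toHomeo.source := by rwa [h2, hγ2]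
      have h4 : (a.quotientChart hπ).SmoothAt b.chart (γ ∘ τ) (π y) :=
        ((hγ1 _).2 _ haA _ hbA hτ hγτ).comp h1 hq hτ
      refine ((b.smoothAt_proj hπ (y := (γ ∘ τ) (π y)) hγτ).comp h4 hq hγτ).congr hq ?_
      filter_upwards [h3] with q hq
      simp only [Function.comp_apply, hγ3, hq, id]
    rintro _ ⟨a, ha, rfl⟩ _ ⟨b, hb, rfl⟩
    rw [LCChart.compatible_iff]
    exact fun q hqa hqb => ⟨key a b ha hb q hqa hqb, key b a hb ha q hqb hqa⟩

theorem SmoothStructure.eq_of_isSubmersion [TopologicalSpace Q] {A : Set (LCChart N)}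
    (hA : IsSmoothAtlas A) {π : N → Q} (hπ : Function.Surjective π) {𝒮 𝒮' : SmoothStructure Q}
    (h : IsSubmersion A 𝒮.atlas π) (h' : IsSubmersion A 𝒮'.atlas π) : 𝒮' = 𝒮 := by
  have key : ∀ 𝒮 𝒮' : SmoothStructure Q, IsSubmersion A 𝒮.atlas π → IsSubmersion A 𝒮'.atlas π →
      ∀ q, SmoothMapAt 𝒮.atlas 𝒮'.atlas id q := by
    intro 𝒮 𝒮' h h' q
    obtain ⟨x, rfl⟩ := hπ q
    obtain ⟨τ, h1, h2, h3⟩ := h.hasSmoothSections hA 𝒮.isSmoothAtlas x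
    exact SmoothMapAt.congr ((h'.smoothMapAt _).comp hA h1) h3
  have sub : ∀ 𝒮 𝒮' : SmoothStructure Q, IsSubmersion A 𝒮.atlas π → IsSubmersion A 𝒮'.atlas π →
      𝒮.atlas ⊆ 𝒮'.atlas := by
    intro 𝒮 𝒮' h h' c hc
    refine 𝒮'.maximal c fun d hd => LCChart.compatible_iff.2 fun x hxc hxd => ?_
    exact ⟨(key _ _ h h' x).2 c hc d hd hxc hxd, (key _ _ h' h x).2 d hd c hc hxd hxc⟩
  have := Subset.antisymm (sub _ _ h' h) (sub _ _ h h')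
  cases 𝒮
  cases 𝒮'
  congr

/-- Existence and uniqueness of the smooth structure on a quotient by an equivalence relation
that is linear in suitable charts and invariant under enough smooth maps. -/
theorem exists_unique_submersion {A : Set (LCChart N)} (hA : IsSmoothAtlas A) {π : N → Q}
    (hπ : Function.Surjective π)
    (ha : ∀ x, ∃ a : AdaptedChart π, a.chart ∈ A ∧ x ∈ a.chart.toHomeo.source)
    (hγ : ∀ x x', π x = π x' → ∃ γ : N → N, (∀ y, SmoothMapAt A A γ y) ∧ γ x = x' ∧
      ∀ y, π (γ y) = π y) :
    ∃ 𝒮 : TopSmoothStructure Q,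
      @IsSubmersion _ _ _ 𝒮.top A (@SmoothStructure.atlas _ 𝒮.top 𝒮.smooth) π ∧
      (∀ 𝒮' : TopSmoothStructure Q,
        @IsSubmersion _ _ _ 𝒮'.top A (@SmoothStructure.atlas _ 𝒮'.top 𝒮'.smooth) π → 𝒮' = 𝒮) ∧
      @IsOpenQuotientMap N Q _ 𝒮.top π := by
  let tQ : TopologicalSpace Q := TopologicalSpace.coinduced π inferInstance
  have hπo : IsOpenQuotientMap π := by
    refine ⟨hπ, continuous_coinduced_rng, fun O hO => isOpen_coinduced.2 ?_⟩
    rw [isOpen_iff_mem_nhds]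
    rintro x ⟨y, hy, hxy⟩
    obtain ⟨γ, h1, h2, h3⟩ := hγ x y hxy.symm
    have hγx := (h1 x).1
    rw [ContinuousAt, h2] at hγx
    filter_upwards [hγx.eventually (hO.mem_nhds hy)] with z hz
    exact ⟨γ z, hz, h3 z⟩
  have hB := isSmoothAtlas_quotientAtlas hπo ha hγ
  have hsub : IsSubmersion A (maximalAtlas (quotientAtlas A hπo)) π := by
    refine ⟨(smoothMapOn_iff isOpen_univ).2 fun x _ => ?_, fun x => ?_⟩
    · obtain ⟨a, haA, hx⟩ := ha x
      exact (a.smoothAt_proj hπo hx).smoothMapAt hA hB.maximalAtlas haA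
        (hB.mem_maximalAtlas ⟨a, haA, rfl⟩) hx (mem_image_of_mem _ hx)
    · obtain ⟨a, haA, hx⟩ := ha x
      exact ⟨a.chart, hA.mem_maximalAtlas haA, a.quotientChart hπo,
        hB.maximalAtlas.mem_maximalAtlas (hB.mem_maximalAtlas ⟨a, haA, rfl⟩), hx,
        fun _ hx => mem_image_of_mem _ hx, a.p, a.σ, a.p_σ, fun _ hy => a.coord_apply hy⟩
  refine ⟨⟨tQ, hB.toSmoothStructure⟩, hsub, ?_, hπo⟩
  rintro ⟨t', 𝒮'⟩ h'
  have ht : t' = tQ := by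
    have h1 : @IsOpenQuotientMap N Q _ t' π :=
      @IsOpenQuotientMap.mk N Q _ t' π hπ
        (continuous_iff_continuousAt.2 fun x => (IsSubmersion.smoothMapAt h' x).1)
        (IsSubmersion.hasSmoothSections hA 𝒮'.isSmoothAtlas h').isOpenMap
    exact h1.isQuotientMap.eq_coinduced
  subst ht
  congr
  exact SmoothStructure.eq_of_isSubmersion hA hπ (𝒮 := hB.toSmoothStructure) hsub h'

end Quotient

section FiniteDimensional

theorem BastianiSmoothAt.exists_hasStrictFDerivAt {E F : Type*} [NormedAddCommGroup E]
    [NormedSpace ℝ E] [FiniteDimensional ℝ E] [NormedAddCommGroup F] [NormedSpace ℝ F]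
    {f : E → F} {x : E} (hf : BastianiSmoothAt f x) :
    ∃ L : E →L[ℝ] F, HasStrictFDerivAt f L x ∧ ∀ h, HasDirDeriv f x h (L h) := by
  obtain ⟨t, ht, hx, hs⟩ := hf
  obtain ⟨-, df, h1, h2⟩ := hs 1
  have h2 : ContinuousOn df (t ×ˢ univ) := h2
  have hsmul : ∀ y ∈ t, ∀ (r : ℝ) h, df (y, r • h) = r • df (y, h) := fun y hy r h =>
    (h1 y hy h).smul (h1 y hy (r • h))
  let L₀ : E →ₗ[ℝ] F :=
    { toFun := fun h => df (x, h)
      map_add' := HasDirDeriv.additive ht h1 h2 hx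
      map_smul' := hsmul x hx }
  let L : E →L[ℝ] F := LinearMap.toContinuousLinearMap L₀
  refine ⟨L, ?_, h1 x hx⟩
  refine HasStrictFDerivAt.of_isLittleO ?_
  rw [Asymptotics.isLittleO_iff]
  intro ε hε
  have hev : ∀ᶠ y in 𝓝 x, ∀ h ∈ Metric.sphere (0 : E) 1, ‖df (y, h) - df (x, h)‖ < ε := by
    refine (isCompact_sphere (0 : E) 1).eventually_forall_of_forall_eventually fun h _ => ?_
    have hd : ContinuousAt df (x, h) := h2.continuousAt (prod_mem_nhds (ht.mem_nhds hx) univ_mem)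
    have hL : ContinuousAt (fun p : E × E => L p.2) (x, h) := Continuous.continuousAt (by fun_prop)
    have := (hd.sub hL).norm
    refine this.eventually_lt (g := fun _ => ε) continuousAt_const ?_
    simpa [L, L₀] using hε
  obtain ⟨δ, hδ, hball⟩ := Metric.eventually_nhds_iff_ball.1 (hev.and (ht.mem_nhds hx))
  have hle : ∀ y ∈ Metric.ball x δ, ∀ h, ‖df (y, h) - L h‖ ≤ ε * ‖h‖ := by
    intro y hy h
    by_cases hh : h = 0
    · subst hh
      have := hsmul y (hball y hy).2 0 0
      simp only [zero_smul] at this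
      simp [this]
    · have hn : ‖h‖ ≠ 0 := norm_ne_zero_iff.2 hh
      have h3 := (hball y hy).1 (‖h‖⁻¹ • h) (by simp [norm_smul, hn])
      rw [hsmul y (hball y hy).2, hsmul x hx, ← smul_sub, norm_smul, norm_inv, norm_norm,
        inv_mul_lt_iff₀ (norm_pos_iff.2 hh), mul_comm] at h3
      exact h3.le
  have hb : ∀ᶠ p : E × E in 𝓝 (x, x), p ∈ Metric.ball x δ ×ˢ Metric.ball x δ :=
    prod_mem_nhds (Metric.ball_mem_nhds x hδ) (Metric.ball_mem_nhds x hδ)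
  filter_upwards [hb] with p hp
  have hseg : ∀ s ∈ Icc (0 : ℝ) 1, p.2 + s • (p.1 - p.2) ∈ Metric.ball x δ := fun s hs =>
    (convex_ball x δ).add_smul_sub_mem hp.2 hp.1 hs
  have key := sub_mem_of_hasDirDeriv (f := f) (x := p.2) (h := p.1 - p.2)
    (w := fun s => df (p.2 + s • (p.1 - p.2), p.1 - p.2))
    (convex_closedBall (L (p.1 - p.2)) (ε * ‖p.1 - p.2‖)) Metric.isClosed_closedBall
    (fun s hs => h1 _ (hball _ (hseg s hs)).2 _)
    (fun s hs => by
      rw [mem_closedBall_iff_norm]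
      exact hle _ (hseg s hs) _)
  rw [mem_closedBall_iff_norm] at key
  simpa using key

/-- The inverse function theorem for maps with injective derivative of a finite-dimensional space
to itself. -/
theorem BastianiSmoothAt.map_nhds_eq {E : Type*} [AddCommGroup E] [Module ℝ E]
    [TopologicalSpace E] [IsTopologicalAddGroup E] [ContinuousSMul ℝ E] [T2Space E]
    [LocallyConvexSpace ℝ E] [FiniteDimensional ℝ E] {f : E → E} {x : E} (hf : BastianiSmoothAt f x)
    (hinj : ∀ h, HasDirDeriv f x h 0 → h = 0) : map f (𝓝 x) = 𝓝 (f x) := by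
  let n := Module.finrank ℝ E
  have Φ : E ≃L[ℝ] (Fin n → ℝ) :=
    (LinearEquiv.ofFinrankEq E (Fin n → ℝ) (by simp [n])).toContinuousLinearEquiv
  have hf' : BastianiSmoothAt f (Φ.symm (Φ x)) := by rwa [Φ.symm_apply_apply]
  have hg : BastianiSmoothAt (Φ ∘ f ∘ Φ.symm) (Φ x) :=
    ((Φ : E →L[ℝ] Fin n → ℝ).bastianiSmoothAt _).comp
      (hf'.comp ((Φ.symm : (Fin n → ℝ) →L[ℝ] E).bastianiSmoothAt (Φ x)))
  obtain ⟨L, hL, hd⟩ := hg.exists_hasStrictFDerivAt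
  have hLinj : Function.Injective L := by
    refine (injective_iff_map_eq_zero L).2 fun h hh => ?_
    have h1 := hd h
    rw [hh] at h1
    have h2 := h1.clm_comp (Φ.symm : (Fin n → ℝ) →L[ℝ] E)
    rw [map_zero] at h2
    have h3 := hinj (Φ.symm h) (h2.congr' ?_)
    · simpa using h3
    · refine Eventually.of_forall fun t => ?_
      simp
  have hLsurj : (L : (Fin n → ℝ) →ₗ[ℝ] Fin n → ℝ).range = ⊤ :=
    LinearMap.range_eq_top.2 (LinearMap.injective_iff_surjective.1 hLinj)
  have key := hL.map_nhds_eq_of_surj hLsurj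
  have h1 : f = Φ.symm ∘ (Φ ∘ f ∘ Φ.symm) ∘ Φ := by
    ext y
    simp
  have h2 : map Φ (𝓝 x) = 𝓝 (Φ x) := Φ.toHomeomorph.map_nhds_eq x
  have h3 : map Φ.symm (𝓝 (Φ (f x))) = 𝓝 (f x) := by
    have := Φ.symm.toHomeomorph.map_nhds_eq (Φ (f x))
    simpa using this
  rw [h1, ← map_map, ← map_map, h2, key]
  simpa using h3

theorem HasDirDeriv.eq_zero_of_leftInverse {E F : Type*} [AddCommGroup E] [Module ℝ E]
    [TopologicalSpace E] [IsTopologicalAddGroup E] [ContinuousSMul ℝ E] [T2Space E]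
    [LocallyConvexSpace ℝ E]
    [AddCommGroup F] [Module ℝ F]
    [TopologicalSpace F] [IsTopologicalAddGroup F] [ContinuousSMul ℝ F]
    {f : E → F} {g : F → E} {x h : E} (hg : BastianiSmoothAt g (f x))
    (hgf : g ∘ f =ᶠ[𝓝 x] id) (hf : HasDirDeriv f x h 0) : h = 0 := by
  obtain ⟨t, ht, hx, hs⟩ := hg
  obtain ⟨-, dg, h1, h2⟩ := hs 1
  have h3 := (HasDirDeriv.comp ht h1 h2 hx hf).congr hgf
  rw [(h1 _ hx 0).unique (hasDirDeriv_zero _)] at h3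
  exact (hasDirDeriv_clm (ContinuousLinearMap.id ℝ E) x h).unique h3

end FiniteDimensional

section CompactGroups

theorem MonoidHom.surjective_of_map_nhds_one_eq {K : Type*} [Group K] [TopologicalSpace K]
    [IsTopologicalGroup K] [CompactSpace K] (hK : connectedComponent (1 : K) ∈ 𝓝 1)
    (κ : K →* K) (hκ : Continuous κ) (hinj : Function.Injective κ)
    (hmap : map κ (𝓝 1) = 𝓝 1) : Function.Surjective κ := by
  set C : Subgroup K := Subgroup.connectedComponentOfOne K with hC
  have hCC : (C : Set K) = connectedComponent 1 := rfl
  have hCo : IsOpen (C : Set K) := C.isOpen_of_mem_nhds (g := 1) hK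
  have hle : C.map κ ≤ C := by
    rintro _ ⟨x, hx, rfl⟩
    have := hκ.image_connectedComponent_subset 1 (mem_image_of_mem κ hx)
    rwa [map_one] at this
  have hge : C ≤ C.map κ := by
    have hmem : (C.map κ : Set K) ∈ 𝓝 1 := by
      rw [← hmap]
      exact image_mem_map hK
    have ho : IsOpen (C.map κ : Set K) := (C.map κ).isOpen_of_mem_nhds (g := 1) hmem
    have hcl : IsClosed (C.map κ : Set K) := (C.map κ).isClosed_of_isOpen ho
    exact IsClopen.connectedComponent_subset ⟨hcl, ho⟩ (C.map κ).one_mem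
  have hfin : Finite (K ⧸ C) := C.quotient_finite_of_isOpen hCo
  let φ : K ⧸ C → K ⧸ C := Quotient.map' κ fun x y hxy => by
    rw [QuotientGroup.leftRel_apply] at hxy ⊢
    rw [← map_inv, ← map_mul]
    exact hle ⟨_, hxy, rfl⟩
  have hφ : Function.Injective φ := by
    intro p q
    induction p using QuotientGroup.induction_on with | _ x
    induction q using QuotientGroup.induction_on with | _ y
    intro h
    have h : ((κ x : K) : K ⧸ C) = (κ y : K) := h
    rw [QuotientGroup.eq, ← map_inv, ← map_mul] at h
    rw [QuotientGroup.eq]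
    obtain ⟨z, hz, hzz⟩ := hge h
    rwa [← hinj hzz]
  intro y
  obtain ⟨q, hq⟩ := (Finite.injective_iff_surjective.1 hφ) (y : K ⧸ C)
  induction q using QuotientGroup.induction_on with | _ x
  have hq : ((κ x : K) : K ⧸ C) = (y : K) := hq
  rw [QuotientGroup.eq] at hq
  obtain ⟨z, -, hz⟩ := hge hq
  exact ⟨x * z, by rw [map_mul, hz, mul_inv_cancel_left]⟩

theorem LCChart.finiteDimensional {X : Type*} [TopologicalSpace X] [LocallyCompactSpace X]
    (c : LCChart X) {x : X} (hx : x ∈ c.toHomeo.source) : FiniteDimensional ℝ c.E := by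
  obtain ⟨C, hC, hCs, hCc⟩ := LocallyCompactSpace.local_compact_nhds x _
    (c.toHomeo.open_source.mem_nhds hx)
  have h1 : IsCompact (c.toHomeo '' C) := hCc.image_of_continuousOn (c.toHomeo.continuousOn.mono hCs)
  have h2 : c.toHomeo '' C ∈ 𝓝 (c.toHomeo x) := c.toHomeo.image_mem_nhds hx hC
  let : UniformSpace c.E := IsTopologicalAddGroup.rightUniformSpace c.E
  have : IsUniformAddGroup c.E := isUniformAddGroup_of_addCommGroup
  exact FiniteDimensional.of_totallyBounded_nhds ℝ h2 h1.totallyBounded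

theorem LCChart.connectedComponent_mem_nhds {X : Type*} [TopologicalSpace X]
    (c : LCChart X) {x : X} (hx : x ∈ c.toHomeo.source) : connectedComponent x ∈ 𝓝 x := by
  obtain ⟨W, ⟨hW1, hW2⟩, hW3⟩ := (LocallyConvexSpace.convex_basis (𝕜 := ℝ) (c.toHomeo x)).mem_iff.1
    (c.toHomeo.open_target.mem_nhds (c.toHomeo.map_source hx))
  have hW3 : W ⊆ c.toHomeo.target := hW3
  have h1 : IsPreconnected (c.toHomeo.symm '' W) :=
    hW2.isPreconnected.image _ (c.toHomeo.symm.continuousOn.mono hW3)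
  have h2 : c.toHomeo.symm '' W ∈ 𝓝 x := by
    have := c.toHomeo.symm.image_mem_nhds (c.toHomeo.map_source hx) hW1
    rwa [c.toHomeo.left_inv hx] at this
  exact mem_of_superset h2 (h1.subset_connectedComponent (mem_of_mem_nhds h2))

end CompactGroups

section LieSubgroup

variable {G : Type u} [Group G] [TopologicalSpace G]

theorem IsLieGroupStructure.isTopologicalGroup {𝒢 : SmoothStructure G}
    (h : IsLieGroupStructure 𝒢) : IsTopologicalGroup G where
  continuous_mul := continuousOn_univ.1 h.1.1
  continuous_inv := continuousOn_univ.1 h.2.1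

theorem IsLieGroupStructure.smoothMapAt_conj {𝒢 : SmoothStructure G}
    (h : IsLieGroupStructure 𝒢) (a y : G) :
    SmoothMapAt 𝒢.atlas 𝒢.atlas (fun g => a * g * a⁻¹) y := by
  have hm : ∀ y, SmoothMapAt 𝒢.atlas 𝒢.atlas (fun g => a * g) y := fun y =>
    SmoothMapAt.partial_snd (f := fun p : G × G => p.1 * p.2) 𝒢.isSmoothAtlas
      ((smoothMapOn_iff isOpen_univ).1 h.1 (a, y) (mem_univ _))
  have hi : ∀ y, SmoothMapAt 𝒢.atlas 𝒢.atlas (fun g : G => g⁻¹) y := fun y =>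
    (smoothMapOn_iff isOpen_univ).1 h.2 y (mem_univ _)
  have h1 := (hm _).comp 𝒢.isSmoothAtlas ((hi _).comp 𝒢.isSmoothAtlas
    ((hm _).comp 𝒢.isSmoothAtlas (hi y)))
  refine h1.congr (Eventually.of_forall fun g => ?_)
  simp [mul_assoc]

/-- A compact Lie subgroup that is conjugated into itself by `a` is conjugated onto itself. -/
theorem IsLieGroupStructure.conj_surjOn [T2Space G] {𝒢 : SmoothStructure G}
    (h𝒢 : IsLieGroupStructure 𝒢) {K : Subgroup G} (hK : IsSubmanifold 𝒢.atlas (K : Set G))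
    (hcK : IsCompact (K : Set G)) {a : G} (ha : ∀ k ∈ K, a * k * a⁻¹ ∈ K) :
    SurjOn (fun k => a * k * a⁻¹) (K : Set G) K := by
  have := h𝒢.isTopologicalGroup
  have : CompactSpace K := isCompact_iff_compactSpace.1 hcK
  have : LocallyCompactSpace (K : Set G) := inferInstanceAs (LocallyCompactSpace K)
  let κ : K →* K := ((MulAut.conj a).toMonoidHom.comp K.subtype).codRestrict K
    fun k => ha k k.2
  have hκc : Continuous κ := by
    refine Continuous.subtype_mk (f := fun k : K => a * (k : G) * a⁻¹) ?_ _
    fun_prop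
  have hinj : Function.Injective κ := fun k l hkl => by
    have : a * (k : G) * a⁻¹ = a * l * a⁻¹ := congrArg Subtype.val hkl
    ext
    simpa using this
  obtain ⟨c, hc, h1⟩ := hK ⟨1, K.one_mem⟩
  obtain ⟨φ, hφ, ι, hr⟩ := mem_subAtlas_iff.1 hc
  have := c.finiteDimensional h1
  have h1φ : (1 : G) ∈ φ.toHomeo.source := hr.mem_source_iff.1 h1
  have hconn := c.connectedComponent_mem_nhds h1
  have hκs : c.SmoothAt c κ ⟨1, K.one_mem⟩ := by
    have hk := SmoothMapAt.restrict (f := fun g => a * g * a⁻¹) (N := (K : Set G))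
      𝒢.isSmoothAtlas hK ha (x := ⟨1, K.one_mem⟩) (h𝒢.smoothMapAt_conj a _)
    refine hk.2 c hc c hc h1 ?_
    convert h1
    change a * 1 * a⁻¹ = 1
    simp
  have hκ1 : κ ⟨1, K.one_mem⟩ = ⟨1, K.one_mem⟩ := map_one κ
  set f := c.toHomeo ∘ κ ∘ c.toHomeo.symm with hf
  have hfc : f (c.toHomeo ⟨1, K.one_mem⟩) = c.toHomeo ⟨1, K.one_mem⟩ := by
    simp only [hf, Function.comp_apply, c.toHomeo.left_inv h1, hκ1]
  have key : map f (𝓝 (c.toHomeo ⟨1, K.one_mem⟩)) = 𝓝 (c.toHomeo ⟨1, K.one_mem⟩) := by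
    rw [BastianiSmoothAt.map_nhds_eq hκs.2 fun h hh => ?_]
    · exact congrArg 𝓝 hfc
    have hφ1 : φ.toHomeo 1 = ι (c.toHomeo ⟨1, K.one_mem⟩) := (hr.apply_eq _ h1).symm
    have hs : ∀ b : G, BastianiSmoothAt
        (φ.toHomeo ∘ (fun g => b * g * b⁻¹) ∘ φ.toHomeo.symm) (φ.toHomeo 1) := fun b =>
      ((h𝒢.smoothMapAt_conj b 1).2 φ hφ φ hφ h1φ (by simpa using h1φ)).2
    set F := φ.toHomeo ∘ (fun g => a * g * a⁻¹) ∘ φ.toHomeo.symm with hF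
    have hF1 : F (φ.toHomeo 1) = φ.toHomeo 1 := by
      simp [hF, φ.toHomeo.left_inv h1φ]
    have hFd : HasDirDeriv F (φ.toHomeo 1) (ι h) 0 := by
      have h2 := hh.clm_comp ι
      rw [map_zero] at h2
      have hev : (fun z => ι (f z)) =ᶠ[𝓝 (c.toHomeo ⟨1, K.one_mem⟩)] F ∘ ι := by
        have h3 : ∀ᶠ y in 𝓝 (⟨1, K.one_mem⟩ : (K : Set G)), κ y ∈ c.toHomeo.source := by
          refine hκs.1.eventually (c.toHomeo.open_source.mem_nhds ?_)
          rw [hκ1]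
          exact h1
        filter_upwards [(c.tendsto_symm h1).eventually h3,
          c.toHomeo.open_target.mem_nhds (c.toHomeo.map_source h1)] with z hz hz'
        have h4 : ι z = φ.toHomeo (c.toHomeo.symm z : (K : Set G)) := by
          rw [← hr.apply_eq _ (c.toHomeo.map_target hz'), c.toHomeo.right_inv hz']
        have h5 := hr.mem_source_iff.1 (c.toHomeo.map_target hz')
        simp only [hf, hF, Function.comp_apply]
        rw [hr.apply_eq _ hz, h4, φ.toHomeo.left_inv h5]
        rfl
      have h3 := h2.congr hev
      rw [hφ1]
      refine Tendsto.congr (fun t => ?_) h3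
      simp
    have hz := HasDirDeriv.eq_zero_of_leftInverse
      (g := φ.toHomeo ∘ (fun g => a⁻¹ * g * a⁻¹⁻¹) ∘ φ.toHomeo.symm)
      (by rw [hF1]; exact hs a⁻¹) ?_ hFd
    · exact hr.isClosedEmbedding.injective (hz.trans (map_zero ι).symm)
    · have hca : Tendsto (fun g => a * g * a⁻¹) (𝓝 1) (𝓝 1) := by
        have := (h𝒢.smoothMapAt_conj a 1).1
        simpa [ContinuousAt] using this
      filter_upwards [(φ.tendsto_symm h1φ).eventually
        (hca.eventually (φ.toHomeo.open_source.mem_nhds h1φ)),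
        φ.toHomeo.open_target.mem_nhds (φ.toHomeo.map_source h1φ)] with z hz hz'
      simp only [hF, Function.comp_apply, φ.toHomeo.left_inv hz]
      simp [mul_assoc, φ.toHomeo.right_inv hz']
  have hmap : map κ (𝓝 1) = 𝓝 1 := by
    have e1 : map c.toHomeo (𝓝 ⟨1, K.one_mem⟩) = 𝓝 (c.toHomeo ⟨1, K.one_mem⟩) :=
      c.toHomeo.map_nhds_eq h1
    have e2 : map c.toHomeo.symm (𝓝 (c.toHomeo ⟨1, K.one_mem⟩)) = 𝓝 ⟨1, K.one_mem⟩ := by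
      have := c.toHomeo.symm.map_nhds_eq (c.toHomeo.map_source h1)
      rwa [c.toHomeo.left_inv h1] at this
    have e3 : κ =ᶠ[𝓝 (⟨1, K.one_mem⟩ : (K : Set G))] c.toHomeo.symm ∘ f ∘ c.toHomeo := by
      have h3 : ∀ᶠ y in 𝓝 (⟨1, K.one_mem⟩ : (K : Set G)), κ y ∈ c.toHomeo.source := by
        refine hκs.1.eventually (c.toHomeo.open_source.mem_nhds ?_)
        rw [hκ1]
        exact h1
      filter_upwards [h3, c.toHomeo.open_source.mem_nhds h1] with y hy hy'
      simp only [hf, Function.comp_apply, c.toHomeo.left_inv hy', c.toHomeo.left_inv hy]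
    have e4 := map_congr e3
    rw [← map_map, ← map_map, e1, key, e2] at e4
    exact e4
  intro k hk
  obtain ⟨l, hl⟩ := MonoidHom.surjective_of_map_nhds_one_eq (K := K) hconn κ hκc hinj hmap ⟨k, hk⟩
  exact ⟨l, l.2, congrArg Subtype.val hl⟩

end LieSubgroup

section Pullback

variable {X Y : Type u} [TopologicalSpace X] [TopologicalSpace Y]

/-- The chart obtained from a chart of `Y` by composition with a local homeomorphism. -/
def LCChart.pullback (c : LCChart Y) (e : OpenPartialHomeomorph X Y) : LCChart X where
  E := c.E
  toHomeo := e.trans c.toHomeo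

theorem LCChart.mem_pullback_source {c : LCChart Y} {e : OpenPartialHomeomorph X Y} {x : X} :
    x ∈ (c.pullback e).toHomeo.source ↔ x ∈ e.source ∧ e x ∈ c.toHomeo.source := by
  simp [pullback]

theorem LCChart.smoothAt_pullback (c : LCChart Y) (e : OpenPartialHomeomorph X Y) {x : X}
    (hx : x ∈ (c.pullback e).toHomeo.source) : (c.pullback e).SmoothAt c e x := by
  refine ⟨e.continuousAt (mem_pullback_source.1 hx).1, (bastianiSmoothAt_id _).congr ?_⟩
  filter_upwards [(c.pullback e).toHomeo.open_target.mem_nhds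
    ((c.pullback e).toHomeo.map_source hx)] with z hz
  exact ((c.pullback e).toHomeo.right_inv hz).symm

theorem LCChart.smoothAt_pullback_symm (c : LCChart Y) (e : OpenPartialHomeomorph X Y) {x : X}
    (hx : x ∈ (c.pullback e).toHomeo.source) : c.SmoothAt (c.pullback e) e.symm (e x) := by
  have h := mem_pullback_source.1 hx
  refine ⟨e.symm.continuousAt (e.map_source h.1), (bastianiSmoothAt_id _).congr ?_⟩
  filter_upwards [(c.pullback e).toHomeo.open_target.mem_nhds
    ((c.pullback e).toHomeo.map_source hx)] with z hz
  exact ((c.pullback e).toHomeo.right_inv hz).symm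

theorem IsDiffeo.pullback_mem_maximalAtlas {A : Set (LCChart X)} {B : Set (LCChart Y)}
    (hA : IsSmoothAtlas A) (hB : IsSmoothAtlas B) {e : OpenPartialHomeomorph X Y}
    (he : IsDiffeo A B e) {c : LCChart X} (hc : c ∈ maximalAtlas A) :
    c.pullback e.symm ∈ maximalAtlas B := by
  intro d hd
  rw [LCChart.compatible_iff]
  intro y hy hyd
  have hy' := LCChart.mem_pullback_source.1 hy
  have hd' := hB.mem_maximalAtlas hd
  have h1 := (((smoothMapOn_iff e.open_source).1 he.1 (e.symm y)
    (e.map_target hy'.1)).maximalAtlas hA hB).2 c hc d hd' hy'.2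
    (by rwa [e.right_inv hy'.1])
  have h2 := (((smoothMapOn_iff e.open_target).1 he.2 y hy'.1).maximalAtlas hB hA).2 d hd' c hc
    hyd hy'.2
  have hev : e ∘ e.symm =ᶠ[𝓝 y] id := by
    filter_upwards [e.open_target.mem_nhds hy'.1] with z hz
    exact e.right_inv hz
  exact ⟨(h1.comp (c.smoothAt_pullback e.symm hy) hy hy'.2).congr hy hev,
    (((c.smoothAt_pullback_symm e.symm hy)).comp h2 hyd hy'.2).congr hyd hev⟩

theorem LCChart.prod_mem_maximalAtlas {A : Set (LCChart X)} {B : Set (LCChart Y)}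
    (hA : IsSmoothAtlas A) (hB : IsSmoothAtlas B) {c : LCChart X} {d : LCChart Y}
    (hc : c ∈ maximalAtlas A) (hd : d ∈ maximalAtlas B) :
    c.prod d ∈ maximalAtlas (prodAtlas A B) := by
  rintro _ ⟨c', hc', d', hd', rfl⟩
  exact (hA.maximalAtlas.prodAtlas hB.maximalAtlas).compatible _ ⟨c, hc, d, hd, rfl⟩ _
    ⟨c', hA.mem_maximalAtlas hc', d', hB.mem_maximalAtlas hd', rfl⟩

end Pullback

section OrbitTypes

variable {G M : Type u} [Group G] [MulAction G M]

theorem smul_mem_orbitTypeSet_iff {H : Subgroup G} {g : G} {m : M} :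
    g • m ∈ orbitTypeSet M H ↔ m ∈ orbitTypeSet M H := by
  have key : ∀ (g : G) (m : M), m ∈ orbitTypeSet M H → g • m ∈ orbitTypeSet M H := by
    rintro g m ⟨a, ha⟩
    refine ⟨g * a, ?_⟩
    rw [MulAction.stabilizer_smul_eq_stabilizer_map_conj, ha, Subgroup.map_map]
    congr 1
    ext
    simp [mul_assoc]
  refine ⟨fun h => ?_, key g m⟩
  simpa using key g⁻¹ _ h

theorem orbitTypeSet_stabilizer {H : Subgroup G} {m : M} (hm : m ∈ orbitTypeSet M H) :
    orbitTypeSet M (MulAction.stabilizer G m) = orbitTypeSet M H := by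
  obtain ⟨a, ha⟩ := hm
  have h1 : ∀ b : G, (MulAction.stabilizer G m).map (MulAut.conj b).toMonoidHom =
      H.map (MulAut.conj (b * a)).toMonoidHom := by
    intro b
    rw [ha, Subgroup.map_map]
    congr 1
    ext
    simp [mul_assoc]
  ext x
  constructor
  · rintro ⟨b, hb⟩
    exact ⟨b * a, by rw [hb, h1]⟩
  · rintro ⟨b, hb⟩
    exact ⟨b * a⁻¹, by rw [hb, h1, inv_mul_cancel_right]⟩

theorem orbitTypeProj_eq_iff {H : Subgroup G} {x y : orbitTypeSet M H} :
    orbitTypeProj M H x = orbitTypeProj M H y ↔ ∃ g : G, g • (y : M) = x :=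
  Quotient.eq.trans Iff.rfl

variable [TopologicalSpace G] [TopologicalSpace M]

theorem IsProperAction.isCompact_stabilizer (h : IsProperAction G M) (m : M) :
    IsCompact (MulAction.stabilizer G m : Set G) := by
  convert (h {(m, m)} isCompact_singleton).image continuous_fst
  ext g
  simp only [SetLike.mem_coe, MulAction.mem_stabilizer_iff, mem_image, mem_preimage,
    mem_singleton_iff, Prod.mk.injEq, Prod.exists]
  constructor
  · intro hg
    exact ⟨g, m, ⟨hg, rfl⟩, rfl⟩
  · rintro ⟨g', m', ⟨h1, rfl⟩, rfl⟩
    exact h1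

theorem IsSlice.stabilizer_eq [T2Space G] {𝒢 : SmoothStructure G} (h𝒢 : IsLieGroupStructure 𝒢)
    {ℳ : SmoothStructure M} (hproper : IsProperAction G M) {m : M} {S : Set M}
    (hS : IsSlice 𝒢 ℳ m S) {s : M} (hs : s ∈ S)
    (hs' : s ∈ orbitTypeSet M (MulAction.stabilizer G m)) :
    MulAction.stabilizer G s = MulAction.stabilizer G m := by
  obtain ⟨a, ha⟩ := hs'
  have hle : MulAction.stabilizer G s ≤ MulAction.stabilizer G m := fun g hg =>
    hS.mem_stabilizer g s hs (by rwa [MulAction.mem_stabilizer_iff.1 hg])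
  have hmem : ∀ k ∈ MulAction.stabilizer G m, a * k * a⁻¹ ∈ MulAction.stabilizer G s :=
    fun k hk => by
      rw [ha]
      exact ⟨k, hk, rfl⟩
  refine le_antisymm hle fun k hk => ?_
  obtain ⟨l, hl, rfl⟩ := h𝒢.conj_surjOn hS.lieSubgroup (hproper.isCompact_stabilizer m)
    (fun k hk => hle (hmem k hk)) hk
  exact hmem l hl

/-- Around each of its points, `M_(H)` is linear in a chart of `M` whose coordinates split into
coordinates along the orbits and coordinates of the quotient. -/
theorem exists_adaptedChart [T2Space G] {𝒢 : SmoothStructure G} (h𝒢 : IsLieGroupStructure 𝒢)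
    {ℳ : SmoothStructure M} (hproper : IsProperAction G M)
    (hslice : ∀ m : M, ∃ S : Set M, IsSlice 𝒢 ℳ m S) {H : Subgroup G} (x : orbitTypeSet M H) :
    ∃ a : AdaptedChart (orbitTypeProj M H),
      a.chart ∈ subAtlas ℳ.atlas (orbitTypeSet M H) ∧ x ∈ a.chart.toHomeo.source := by
  obtain ⟨m, hm⟩ := x
  obtain ⟨S, hS⟩ := hslice m
  obtain ⟨𝒬, -, U, χ, -, -, -, -, e, hes, heχ, hme, he⟩ := hS.principal
  have hN := orbitTypeSet_stabilizer hm
  have hAS := hS.submanifold.isSmoothAtlas ℳ.isSmoothAtlas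
  have he_apply : ∀ y ∈ e.target, y = χ (e.symm y).1 • ((e.symm y).2 : M) := by
    intro y hy
    have h1 := e.map_target hy
    rw [hes] at h1
    rw [← heχ _ h1.1, Prod.mk.eta, e.right_inv hy]
  obtain ⟨cQ, hcQ, hmQ⟩ := 𝒬.cover (e.symm m).1
  have hsm : (e.symm m).2 ∈
      (Subtype.val : S → M) ⁻¹' orbitTypeSet M (MulAction.stabilizer G m) := by
    rw [mem_preimage, hN, ← smul_mem_orbitTypeSet_iff (g := χ (e.symm m).1), ← he_apply m hme]
    exact hm
  obtain ⟨cS, hcS, hmcS⟩ := hS.partialSlice_submanifold ⟨_, hsm⟩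
  obtain ⟨ψ, hψ, κ, hr⟩ := mem_subAtlas_iff.1 hcS
  have hmψ := hr.mem_source_iff.1 hmcS
  set φ : LCChart M := (cQ.prod ψ).pullback e.symm with hφ
  have hφA : φ ∈ ℳ.atlas := by
    rw [← ℳ.maximalAtlas_eq]
    exact he.pullback_mem_maximalAtlas (𝒬.isSmoothAtlas.prodAtlas hAS) ℳ.isSmoothAtlas
      (LCChart.prod_mem_maximalAtlas 𝒬.isSmoothAtlas hAS
        (𝒬.isSmoothAtlas.mem_maximalAtlas hcQ) hψ)
  have hφs : ∀ {y : M}, y ∈ φ.toHomeo.source ↔ y ∈ e.target ∧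
      (e.symm y).1 ∈ cQ.toHomeo.source ∧ (e.symm y).2 ∈ ψ.toHomeo.source := fun {y} =>
    LCChart.mem_pullback_source
  have hNiff : ∀ y ∈ e.target, y ∈ orbitTypeSet M H ↔
      ((e.symm y).2 : M) ∈ orbitTypeSet M (MulAction.stabilizer G m) := by
    intro y hy
    rw [hN, ← smul_mem_orbitTypeSet_iff (g := χ (e.symm y).1) (m := ((e.symm y).2 : M)),
      ← he_apply y hy]
  let ι : cQ.E × cS.E →L[ℝ] φ.E := (ContinuousLinearMap.id ℝ cQ.E).prodMap κ
  have hι : IsClosedEmbedding ι := IsClosedEmbedding.id.prodMap hr.isClosedEmbedding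
  have himage : φ.toHomeo '' (φ.toHomeo.source ∩ orbitTypeSet M H) =
      φ.toHomeo.target ∩ range ι := by
    ext w
    constructor
    · rintro ⟨y, ⟨hy, hyN⟩, rfl⟩
      refine ⟨φ.toHomeo.map_source hy, ?_⟩
      have hy' := hφs.1 hy
      obtain ⟨-, z, hz⟩ := hr.image_eq.le ⟨_, ⟨hy'.2.2, (hNiff y hy'.1).1 hyN⟩, rfl⟩
      exact ⟨(cQ.toHomeo (e.symm y).1, z), Prod.ext rfl hz⟩
    · rintro ⟨hw, ⟨z, rfl⟩⟩
      have hy := φ.toHomeo.map_target hw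
      refine ⟨_, ⟨hy, ?_⟩, φ.toHomeo.right_inv hw⟩
      have hy' := hφs.1 hy
      have h2 : ψ.toHomeo (e.symm (φ.toHomeo.symm (ι z))).2 = κ z.2 :=
        congrArg Prod.snd (φ.toHomeo.right_inv hw)
      rw [hNiff _ hy'.1]
      obtain ⟨s, hs, hsz⟩ := hr.image_eq.ge
        ⟨h2 ▸ ψ.toHomeo.map_source hy'.2.2, mem_range_self z.2⟩
      have h3 : s = (e.symm (φ.toHomeo.symm (ι z))).2 :=
        ψ.toHomeo.injOn hs.1 hy'.2.2 (hsz.trans h2.symm)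
      rw [← h3]
      exact hs.2
  have hc := φ.isRestrictedChart_restrict (orbitTypeSet M H) ⟨m, hm⟩ ι hι himage
  set c := φ.restrict (orbitTypeSet M H) ⟨m, hm⟩ ι hι himage
  have hmc : ⟨m, hm⟩ ∈ c.toHomeo.source := hc.mem_source_iff.2 (hφs.2 ⟨hme, hmQ, hmψ⟩)
  have hsnd : ∀ y ∈ c.toHomeo.source,
      κ (c.toHomeo y : cQ.E × cS.E).2 = ψ.toHomeo (e.symm y).2 := fun y hy =>
    congrArg Prod.snd (hc.apply_eq y hy)
  refine ⟨{ chart := c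
            base := ⟨m, hm⟩
            base_mem := hmc
            F := cS.E
            p := ContinuousLinearMap.snd ℝ cQ.E cS.E
            σ := ContinuousLinearMap.inr ℝ cQ.E cS.E
            p_σ := fun _ => rfl
            eq_iff := ?_ }, mem_subAtlas_iff.2 ⟨φ, hφA, ι, hc⟩, hmc⟩
  intro y hy y' hy'
  have hys := hφs.1 (hc.mem_source_iff.1 hy)
  have hys' := hφs.1 (hc.mem_source_iff.1 hy')
  have h1 : (c.toHomeo y : cQ.E × cS.E).2 = (c.toHomeo y' : cQ.E × cS.E).2 ↔
      (e.symm (y : M)).2 = (e.symm (y' : M)).2 := by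
    rw [← hr.isClosedEmbedding.injective.eq_iff, hsnd y hy, hsnd y' hy',
      ψ.toHomeo.injOn.eq_iff hys.2.2 hys'.2.2]
  refine Iff.trans ?_ h1.symm
  have h2 := he_apply y hys.1
  have h2' := he_apply y' hys'.1
  rw [orbitTypeProj_eq_iff]
  constructor
  · rintro ⟨g, hg⟩
    set s := (e.symm (y : M)).2
    set s' := (e.symm (y' : M)).2
    have h3 : ((χ (e.symm (y : M)).1)⁻¹ * g * χ (e.symm (y' : M)).1) • (s' : M) = s := by
      rw [mul_smul, mul_smul, ← h2', hg, inv_smul_eq_iff]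
      exact h2
    have h4 := (hS.stabilizer_eq h𝒢 hproper s'.2 ((hNiff y' hys'.1).1 y'.2)).ge
      (hS.mem_stabilizer _ s' s'.2 (h3 ▸ s.2))
    rw [MulAction.mem_stabilizer_iff, h3] at h4
    exact Subtype.ext h4
  · intro h
    refine ⟨χ (e.symm (y : M)).1 * (χ (e.symm (y' : M)).1)⁻¹, ?_⟩
    rw [mul_smul, inv_smul_eq_iff.2 h2', ← h]
    exact h2.symm

theorem IsSmoothAction.smoothMapAt_smul {𝒢 : SmoothStructure G} {ℳ : SmoothStructure M}
    (h : IsSmoothAction 𝒢 ℳ) (g : G) (m : M) :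
    SmoothMapAt ℳ.atlas ℳ.atlas (fun y => g • y) m :=
  SmoothMapAt.partial_snd (f := fun p : G × M => p.1 • p.2) 𝒢.isSmoothAtlas
    ((smoothMapOn_iff isOpen_univ).1 h (g, m) (mem_univ _))

theorem IsProperAction.t2Space_orbitTypeQuotient [T2Space M] [CompactlyCoherentSpace (M × M)]
    (hproper : IsProperAction G M) (hcont : Continuous fun p : G × M => p.1 • p.2)
    {H : Subgroup G} [TopologicalSpace (OrbitTypeQuotient M H)]
    (hπ : IsOpenQuotientMap (orbitTypeProj M H)) : T2Space (OrbitTypeQuotient M H) := by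
  rw [t2Space_iff_of_isOpenQuotientMap hπ]
  have h1 : IsProperMap fun p : G × M => (p.1 • p.2, p.2) :=
    isProperMap_iff_isCompact_preimage.2
      ⟨hcont.prodMk continuous_snd, fun K hK => hproper K hK⟩
  have h2 : Continuous fun q : orbitTypeSet M H × orbitTypeSet M H => ((q.1 : M), (q.2 : M)) := by
    fun_prop
  convert h1.isClosedMap.isClosed_range.preimage h2
  ext q
  simp only [mem_ofPred_eq, orbitTypeProj_eq_iff, mem_preimage, mem_range, Prod.mk.injEq,
    Prod.exists]
  exact ⟨fun ⟨g, hg⟩ => ⟨g, _, hg, rfl⟩, fun ⟨g, y, hg, hy⟩ => ⟨g, hy ▸ hg⟩⟩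

end OrbitTypes

theorem mainTheorem10 {G M : Type u} [Group G] [TopologicalSpace G] [T2Space G]
    [TopologicalSpace M] [T2Space M] [MulAction G M]
    (𝒢 : SmoothStructure G) (h𝒢 : IsLieGroupStructure 𝒢)
    (ℳ : SmoothStructure M) (hsmooth : IsSmoothAction 𝒢 ℳ)
    (hproper : IsProperAction G M)
    (hslice : ∀ m : M, ∃ S : Set M, IsSlice 𝒢 ℳ m S)
    (H : Subgroup G) (hH : ∃ m : M, MulAction.stabilizer G m = H) :
    IsSubmanifold ℳ.atlas (orbitTypeSet M H) ∧
    ∃ 𝒮 : TopSmoothStructure (OrbitTypeQuotient M H),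
      IsSubmersiveQuotientStructure ℳ H 𝒮 ∧
      (∀ 𝒮' : TopSmoothStructure (OrbitTypeQuotient M H),
        IsSubmersiveQuotientStructure ℳ H 𝒮' → 𝒮' = 𝒮) ∧
      (CompactlyCoherentSpace (M × M) → @T2Space (OrbitTypeQuotient M H) 𝒮.top) := by
  have ha := exists_adaptedChart (H := H) h𝒢 hproper hslice
  have hN : IsSubmanifold ℳ.atlas (orbitTypeSet M H) := fun x => by
    obtain ⟨a, haA, hx⟩ := ha x
    exact ⟨a.chart, haA, hx⟩
  obtain ⟨𝒮, h1, h2, h3⟩ := exists_unique_submersion (hN.isSmoothAtlas ℳ.isSmoothAtlas)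
    (π := orbitTypeProj M H) Quotient.mk_surjective ha fun x x' hxx' => by
      obtain ⟨g, hg⟩ := orbitTypeProj_eq_iff.1 hxx'.symm
      have hg' : MapsTo (fun y : M => g • y) (orbitTypeSet M H) (orbitTypeSet M H) :=
        fun y hy => smul_mem_orbitTypeSet_iff.2 hy
      exact ⟨hg'.restrict, fun y => SmoothMapAt.restrict ℳ.isSmoothAtlas hN hg'
        (hsmooth.smoothMapAt_smul g y), Subtype.ext hg,
        fun y => orbitTypeProj_eq_iff.2 ⟨g, rfl⟩⟩
  refine ⟨hN, 𝒮, h1, h2, fun hcc => ?_⟩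
  let := 𝒮.top
  exact hproper.t2Space_orbitTypeQuotient (continuousOn_univ.1 hsmooth.1) h3
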